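/- Let $\mathcal{C}$ be a unital C$^*$-algebra and $n \in \mathbb{N}$. Let $\mathcal{S}^{\mathcal{C}}(\mathbb{R}^n)$ be the space of $\mathcal{C}$-valued Schwartz functions on $\mathbb{R}^n$ (smooth functions which, together with all their partial derivatives, decay more rapidly than the inverse of any polynomial), and let $E_n$ be its completion with respect to the norm $$\|f\|_2 := \Big\| \int_{\mathbb{R}^n} f(x)^* f(x)\, dx \Big\|_{\mathcal{C}}^{1/2}.$$ Let $H_{2n+1}(\mathbb{R})$ be the Heisenberg group, i.e. the Lie group of all real matrices $$g(a,b,c) = \begin{bmatrix} 1 & a^T & c \\ 0 & I_n & b \\ 0 & 0 & 1 \end{bmatrix}, \qquad a, b \in \mathbb{R}^n,\ c \in \mathbb{R},$$ under matrix multiplication. Let $\mathcal{U}$ be the representation of $H_{2n+1}(\mathbb{R})$ on $E_n$ by isometric linear bijections which is obtained by extending by continuity the operators $$(\mathcal{U}_{g(a,b,c)} f)(x) = e^{-ic}\, e^{i \langle b, x\rangle} f(x - a), \qquad f \in \mathcal{S}^{\mathcal{C}}(\mathbb{R}^n),\ x \in \mathbb{R}^n.$$ Call $u \in E_n$ a smooth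 vector for $\mathcal{U}$ if the map $H_{2n+1}(\mathbb{R}) \ni g \mapsto \mathcal{U}_g u \in E_n$ is of class $C^\infty$, and let $C^\infty(\mathcal{U})$ be the subspace of all smooth vectors. Then $$C^\infty(\mathcal{U}) = \mathcal{S}^{\mathcal{C}}(\mathbb{R}^n),$$ where $\mathcal{S}^{\mathcal{C}}(\mathbb{R}^n)$ is identified with its canonical image in $E_n$. The same equality holds when $e^{-ic}$ is replaced by $e^{ic}$ in the formula for $\mathcal{U}_{g(a,b,c)}$ (the resulting family of operators is multiplicative only up to a phase). -/

import Mathlib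

open MeasureTheory
open scoped SchwartzMap ContDiff Manifold

namespace HeisenbergSmooth

/-- Euclidean space `ℝⁿ`. -/
abbrev Rn (n : ℕ) : Type := EuclideanSpace ℝ (Fin n)

/-! ### The pre-Hilbert module of `C`-valued Schwartz functions and its completion -/

/-- The space `S^C(ℝⁿ)` of `C`-valued Schwartz functions; a copy of Mathlib's `𝓢(ℝⁿ, C)`, which
carries the norm `‖∫ f(x)* f(x) dx‖^(1/2)` instead of the Fréchet topology. -/
def PreE (n : ℕ) (C : Type*) [CStarAlgebra C] : Type _ := 𝓢(Rn n, C)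

section PreE

variable {n : ℕ} {C : Type*} [CStarAlgebra C]

noncomputable instance : AddCommGroup (PreE n C) := inferInstanceAs (AddCommGroup 𝓢(Rn n, C))
noncomputable instance : Module ℂ (PreE n C) := inferInstanceAs (Module ℂ 𝓢(Rn n, C))

/-- A Schwartz function as an element of `PreE`. -/
noncomputable def toPreE : 𝓢(Rn n, C) ≃ₗ[ℂ] PreE n C := LinearEquiv.refl ℂ _

instance : FunLike (PreE n C) (Rn n) C := inferInstanceAs (FunLike 𝓢(Rn n, C) (Rn n) C)

@[simp] lemma PreE.add_apply (f g : PreE n C) (x : Rn n) : (f + g) x = f x + g x := rfl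
@[simp] lemma PreE.smul_apply (z : ℂ) (f : PreE n C) (x : Rn n) : (z • f) x = z • f x := rfl
@[simp] lemma PreE.zero_apply (x : Rn n) : (0 : PreE n C) x = 0 := rfl
@[simp] lemma toPreE_apply (f : 𝓢(Rn n, C)) (x : Rn n) : toPreE f x = f x := rfl

lemma PreE.ext {f g : PreE n C} (h : ∀ x, f x = g x) : f = g := DFunLike.ext _ _ h

lemma PreE.continuous (f : PreE n C) : Continuous f := SchwartzMap.continuous (toPreE.symm f)

/-- The `C`-valued inner product `⟨f, g⟩ = ∫ f(x)* g(x) dx`. -/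
noncomputable def preInner (f g : PreE n C) : C := ∫ x, star (f x) * g x

noncomputable instance : Norm (PreE n C) := ⟨fun f => √‖∫ x, star (f x) * f x‖⟩

lemma PreE.norm_def (f : PreE n C) : ‖f‖ = √‖∫ x, star (f x) * f x‖ := rfl

lemma integrable_star_mul (f g : PreE n C) : Integrable fun x => star (f x) * g x := by
  have hg : Integrable (fun x => g x) := SchwartzMap.integrable (toPreE.symm g)
  have hf : Continuous (fun x => star (f x)) := f.continuous.star
  refine hg.bdd_mul (c := SchwartzMap.seminorm ℝ 0 0 (toPreE.symm f)) hf.aestronglyMeasurable ?_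
  refine Filter.Eventually.of_forall fun x => ?_
  rw [norm_star]
  exact SchwartzMap.norm_le_seminorm ℝ (toPreE.symm f) x

/-- The right action of `C` on Schwartz functions, `(f · c)(x) = f(x) c`. -/
noncomputable instance : SMul Cᵐᵒᵖ (PreE n C) :=
  ⟨fun c f => toPreE (SchwartzMap.postcompCLM
    ((ContinuousLinearMap.mul ℝ C).flip c.unop) (toPreE.symm f))⟩

@[simp] lemma PreE.op_smul_apply (c : Cᵐᵒᵖ) (f : PreE n C) (x : Rn n) :
    (c • f) x = f x * c.unop := rfl

lemma preInner_self_eq_zero {f : PreE n C} (h : preInner f f = 0) : f = 0 := by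
  let _ := CStarAlgebra.spectralOrder C
  let _ := CStarAlgebra.spectralOrderedRing C
  have hpos : ∀ x, 0 ≤ star (f x) * f x := fun x => star_mul_self_nonneg _
  have hint := integrable_star_mul f f
  have hae : (fun x => star (f x) * f x) =ᵐ[volume] 0 := by
    refine ae_eq_zero_of_forall_setIntegral_eq_of_sigmaFinite
      (fun s _ _ => hint.integrableOn) fun s _ _ => le_antisymm ?_ ?_
    · exact (setIntegral_le_integral hint (Filter.Eventually.of_forall hpos)).trans h.le
    · exact integral_nonneg hpos
  have hc : Continuous fun x => star (f x) * f x := f.continuous.star.mul f.continuous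
  have := (hc.ae_eq_iff_eq volume continuous_zero).1 hae
  exact PreE.ext fun x => CStarRing.star_mul_self_eq_zero_iff _ |>.1 (congrFun this x)

/-- `S^C(ℝⁿ)` is a pre-Hilbert `C`-module. (Mathlib's convention for the side of the action is met
by viewing the right `C`-module as a module over `Cᵐᵒᵖ`.) -/
noncomputable abbrev PreE.cstarModule :
    letI := CStarAlgebra.spectralOrder C
    CStarModule Cᵐᵒᵖ (PreE n C) :=
  letI := CStarAlgebra.spectralOrder C
  letI := CStarAlgebra.spectralOrderedRing C
  { inner := fun f g => MulOpposite.op (preInner f g)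
    inner_add_right := by
      intro f g h
      rw [← MulOpposite.op_add]
      congr 1
      simp only [preInner, PreE.add_apply, mul_add]
      exact integral_add (integrable_star_mul f g) (integrable_star_mul f h)
    inner_self_nonneg := by
      intro f
      exact integral_nonneg (f := fun x => star (f x) * f x) fun x => star_mul_self_nonneg _
    inner_self := by
      intro f
      constructor
      · intro h
        exact preInner_self_eq_zero (MulOpposite.op_injective h)
      · rintro rfl
        simp [preInner]
    inner_op_smul_right := by
      intro c f g
      apply MulOpposite.unop_injective
      simp only [preInner, PreE.op_smul_apply, MulOpposite.unop_op, MulOpposite.unop_mul,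
        ← mul_assoc]
      exact ((ContinuousLinearMap.mul ℝ C).flip c.unop).integral_comp_comm
        (integrable_star_mul f g)
    inner_smul_right_complex := by
      intro z f g
      rw [← MulOpposite.op_smul]
      congr 1
      simp only [preInner, PreE.smul_apply, mul_smul_comm]
      exact integral_smul z _
    star_inner := by
      intro f g
      rw [← MulOpposite.op_star]
      congr 1
      have := ((starL' ℝ : C ≃L[ℝ] C) : C →L[ℝ] C).integral_comp_comm (integrable_star_mul f g)
      simp only [preInner]
      simpa using this.symm
    norm_eq_sqrt_norm_inner_self := fun f => rfl }

lemma PreE.normedSpaceCore : NormedSpace.Core ℂ (PreE n C) :=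
  letI := CStarAlgebra.spectralOrder C
  letI := CStarAlgebra.spectralOrderedRing C
  letI : CStarModule Cᵐᵒᵖ (PreE n C) := PreE.cstarModule
  CStarModule.normedSpaceCore Cᵐᵒᵖ

noncomputable instance : NormedAddCommGroup (PreE n C) :=
  NormedAddCommGroup.ofCore PreE.normedSpaceCore

noncomputable instance : NormedSpace ℂ (PreE n C) := NormedSpace.ofCore PreE.normedSpaceCore

end PreE

/-- The Banach space `E_n`: the completion of `S^C(ℝⁿ)` for the norm `‖∫ f(x)* f(x) dx‖^(1/2)`. -/
def E (n : ℕ) (C : Type*) [CStarAlgebra C] : Type _ := UniformSpace.Completion (PreE n C)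

section E

variable {n : ℕ} {C : Type*} [CStarAlgebra C]

noncomputable instance : NormedAddCommGroup (E n C) :=
  inferInstanceAs (NormedAddCommGroup (UniformSpace.Completion (PreE n C)))
noncomputable instance : NormedSpace ℂ (E n C) :=
  inferInstanceAs (NormedSpace ℂ (UniformSpace.Completion (PreE n C)))
instance : CompleteSpace (E n C) :=
  inferInstanceAs (CompleteSpace (UniformSpace.Completion (PreE n C)))

/-- The canonical map from `S^C(ℝⁿ)` to its completion `E_n`. -/
noncomputable def toE (n : ℕ) (C : Type*) [CStarAlgebra C] : 𝓢(Rn n, C) →ₗ[ℂ] E n C :=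
  (UniformSpace.Completion.toComplₗᵢ (𝕜 := ℂ) (E := PreE n C)).toLinearMap ∘ₗ
    toPreE.toLinearMap

lemma denseRange_toE : DenseRange (toE n C) := by
  have := (UniformSpace.Completion.denseRange_coe (α := PreE n C)).comp
    (toPreE (n := n) (C := C)).surjective.denseRange
    (UniformSpace.Completion.continuous_coe _)
  exact this

lemma norm_toE (f : 𝓢(Rn n, C)) : ‖toE n C f‖ = √‖∫ x, star (f x) * f x‖ :=
  UniformSpace.Completion.norm_coe (toPreE f)

end E

/-! ### The Heisenberg group -/

/-- The Heisenberg group `H_{2n+1}(ℝ)`, in its global coordinates `(a, b, c)`. The triple stands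
for the matrix `Heisenberg.toMatrix`, and the group law is matrix multiplication. -/
def Heisenberg (n : ℕ) : Type := Rn n × Rn n × ℝ

namespace Heisenberg

variable {n : ℕ}

/-- The coordinate `a`. -/
def a (g : Heisenberg n) : Rn n := g.1
/-- The coordinate `b`. -/
def b (g : Heisenberg n) : Rn n := g.2.1
/-- The coordinate `c`. -/
def c (g : Heisenberg n) : ℝ := g.2.2
/-- The group element with coordinates `a`, `b`, `c`. -/
def mk (a b : Rn n) (c : ℝ) : Heisenberg n := (a, b, c)

@[simp] lemma mk_a (a b : Rn n) (c : ℝ) : (mk a b c).a = a := rfl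
@[simp] lemma mk_b (a b : Rn n) (c : ℝ) : (mk a b c).b = b := rfl
@[simp] lemma mk_c (a b : Rn n) (c : ℝ) : (mk a b c).c = c := rfl

lemma ext {g h : Heisenberg n} (ha : g.a = h.a) (hb : g.b = h.b) (hc : g.c = h.c) : g = h :=
  Prod.ext ha (Prod.ext hb hc)

noncomputable instance : Mul (Heisenberg n) :=
  ⟨fun g h => mk (g.a + h.a) (g.b + h.b) (g.c + h.c + inner ℝ g.a h.b)⟩
instance : One (Heisenberg n) := ⟨mk 0 0 0⟩
noncomputable instance : Inv (Heisenberg n) :=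
  ⟨fun g => mk (-g.a) (-g.b) (-g.c + inner ℝ g.a g.b)⟩

@[simp] lemma mul_a (g h : Heisenberg n) : (g * h).a = g.a + h.a := rfl
@[simp] lemma mul_b (g h : Heisenberg n) : (g * h).b = g.b + h.b := rfl
@[simp] lemma mul_c (g h : Heisenberg n) : (g * h).c = g.c + h.c + inner ℝ g.a h.b := rfl
@[simp] lemma one_a : (1 : Heisenberg n).a = 0 := rfl
@[simp] lemma one_b : (1 : Heisenberg n).b = 0 := rfl
@[simp] lemma one_c : (1 : Heisenberg n).c = 0 := rfl
@[simp] lemma inv_a (g : Heisenberg n) : g⁻¹.a = -g.a := rfl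
@[simp] lemma inv_b (g : Heisenberg n) : g⁻¹.b = -g.b := rfl
@[simp] lemma inv_c (g : Heisenberg n) : g⁻¹.c = -g.c + inner ℝ g.a g.b := rfl

noncomputable instance : Group (Heisenberg n) :=
  Group.ofLeftAxioms
    (fun g h k => ext (by simp [add_assoc]) (by simp [add_assoc])
      (by simp [inner_add_left, inner_add_right]; ring))
    (fun g => ext (by simp) (by simp) (by simp))
    (fun g => ext (by simp) (by simp) (by simp))

/-- The matrix with block rows `(1, aᵀ, c)`, `(0, I_n, b)`, `(0, 0, 1)`. -/
def toMatrix (g : Heisenberg n) : Matrix (Unit ⊕ Fin n ⊕ Unit) (Unit ⊕ Fin n ⊕ Unit) ℝ :=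
  Matrix.fromBlocks 1 (Matrix.fromCols (Matrix.of fun _ j => g.a j) (Matrix.of fun _ _ => g.c))
    0 (Matrix.fromBlocks 1 (Matrix.of fun i _ => g.b i) 0 1)

lemma toMatrix_mul (g h : Heisenberg n) : (g * h).toMatrix = g.toMatrix * h.toMatrix := by
  simp only [toMatrix, Matrix.fromBlocks_multiply]
  congr 1
  · simp
  · ext i j
    rcases j with j | j
    · simp [Matrix.mul_apply, Matrix.fromBlocks, Matrix.fromCols, Matrix.one_apply, add_comm]
    · simp [Matrix.mul_apply, Matrix.fromBlocks, Matrix.fromCols,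
        PiLp.inner_apply, mul_comm]
      ring
  · simp
  · simp
    ext i j
    simp [add_comm]

lemma toMatrix_injective : Function.Injective (toMatrix (n := n)) := by
  intro g h H
  refine ext ?_ ?_ ?_
  · ext j
    exact congrFun (congrFun H (Sum.inl ())) (Sum.inr (Sum.inl j))
  · ext j
    exact congrFun (congrFun H (Sum.inr (Sum.inl j))) (Sum.inr (Sum.inr ()))
  · exact congrFun (congrFun H (Sum.inl ())) (Sum.inr (Sum.inr ()))

instance : TopologicalSpace (Heisenberg n) := inferInstanceAs (TopologicalSpace (Rn n × Rn n × ℝ))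

/-- `(a, b, c)` is a global chart. -/
instance : ChartedSpace (Rn n × Rn n × ℝ) (Heisenberg n) :=
  inferInstanceAs (ChartedSpace (Rn n × Rn n × ℝ) (Rn n × Rn n × ℝ))

instance : IsManifold 𝓘(ℝ, Rn n × Rn n × ℝ) ∞ (Heisenberg n) :=
  inferInstanceAs (IsManifold 𝓘(ℝ, Rn n × Rn n × ℝ) ∞ (Rn n × Rn n × ℝ))

instance : LieGroup 𝓘(ℝ, Rn n × Rn n × ℝ) ∞ (Heisenberg n) where
  contMDiff_mul := by
    have h : ContDiff ℝ ∞ fun p : (Rn n × Rn n × ℝ) × (Rn n × Rn n × ℝ) =>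
        ((p.1.1 + p.2.1, p.1.2.1 + p.2.2.1,
          p.1.2.2 + p.2.2.2 + inner ℝ p.1.1 p.2.2.1) : Rn n × Rn n × ℝ) := by
      have h1 : ContDiff ℝ ∞ fun p : (Rn n × Rn n × ℝ) × (Rn n × Rn n × ℝ) =>
          (inner ℝ p.1.1 p.2.2.1 : ℝ) := ContDiff.inner ℝ (by fun_prop) (by fun_prop)
      fun_prop
    have h' := h.contMDiff
    rw [modelWithCornersSelf_prod, ← chartedSpaceSelf_prod] at h'
    exact h'
  contMDiff_inv := by
    have h : ContDiff ℝ ∞ fun p : Rn n × Rn n × ℝ =>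
        ((-p.1, -p.2.1, -p.2.2 + inner ℝ p.1 p.2.1) : Rn n × Rn n × ℝ) := by
      have h1 : ContDiff ℝ ∞ fun p : Rn n × Rn n × ℝ =>
          (inner ℝ p.1 p.2.1 : ℝ) := ContDiff.inner ℝ (by fun_prop) (by fun_prop)
      fun_prop
    exact h.contMDiff

end Heisenberg

/-! ### The unitary representation -/

section Representation

variable {n : ℕ} {C : Type*} [CStarAlgebra C]

/-- The scalar factor `x ↦ e^{ic} e^{i⟨b, x⟩}`. -/
noncomputable def phase (b : Rn n) (c : ℝ) (x : Rn n) : ℂ :=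
  Complex.exp (Complex.I * c) * Complex.exp (Complex.I * (inner ℝ b x : ℝ))

lemma hasTemperateGrowth_phase (b : Rn n) (c : ℝ) : (phase b c).HasTemperateGrowth := by
  have hexp : (fun t : ℝ => Complex.exp (Complex.I * t)).HasTemperateGrowth := by
    have hd : ∀ k : ℕ, iteratedDeriv k (fun t : ℝ => Complex.exp (Complex.I * t)) =
        fun t : ℝ => Complex.I ^ k * Complex.exp (Complex.I * t) := by
      intro k
      induction k with
      | zero => simp
      | succ k ih =>
        rw [iteratedDeriv_succ, ih]
        ext t
        have h1 : HasDerivAt (fun t : ℝ => Complex.I * (t : ℂ)) Complex.I t := by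
          simpa using (Complex.ofRealCLM.hasDerivAt (x := t)).const_mul Complex.I
        rw [(h1.cexp.const_mul (Complex.I ^ k)).deriv]
        ring
    refine ⟨?_, fun k => ⟨0, 1, fun t => ?_⟩⟩
    · exact Complex.contDiff_exp.comp (contDiff_const.mul Complex.ofRealCLM.contDiff)
    · rw [norm_iteratedFDeriv_eq_norm_iteratedDeriv, hd k]
      simp [mul_comm Complex.I, Complex.norm_exp_ofReal_mul_I]
  exact (Function.HasTemperateGrowth.const (Complex.exp (Complex.I * c))).mul
    (hexp.comp (Function.hasTemperateGrowth_inner_right b))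

lemma star_phase_mul_phase (b : Rn n) (c : ℝ) (x : Rn n) :
    star (phase b c x) * phase b c x = 1 := by
  have h : ‖phase b c x‖ = 1 := by
    simp [phase, mul_comm Complex.I, Complex.norm_exp_ofReal_mul_I]
  rw [Complex.star_def, Complex.conj_mul', h]
  simp

/-- The operator `f ↦ (x ↦ e^{ic} e^{i⟨b, x⟩} f(x - a))` on `S^C(ℝⁿ)`. -/
noncomputable def schwartzOp (a b : Rn n) (c : ℝ) : 𝓢(Rn n, C) →ₗ[ℂ] 𝓢(Rn n, C) :=
  (SchwartzMap.smulLeftCLM C (phase b c) ∘L SchwartzMap.compSubConstCLM ℂ a).toLinearMap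

lemma schwartzOp_apply (a b : Rn n) (c : ℝ) (f : 𝓢(Rn n, C)) (x : Rn n) :
    schwartzOp a b c f x =
      (Complex.exp (Complex.I * c) * Complex.exp (Complex.I * (inner ℝ b x : ℝ))) • f (x - a) := by
  simp [schwartzOp, hasTemperateGrowth_phase, phase]

lemma schwartzOp_comp (a b a' b' : Rn n) (c c' : ℝ) (f : 𝓢(Rn n, C)) :
    schwartzOp a b c (schwartzOp a' b' c' f) =
      schwartzOp (a + a') (b + b') (c + c' - inner ℝ a b') f := by
  ext x
  simp only [schwartzOp_apply, smul_smul, ← Complex.exp_add, sub_sub]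
  congr 2
  simp only [inner_add_left, inner_sub_right, real_inner_comm b' a]
  push_cast
  ring

lemma schwartzOp_zero (f : 𝓢(Rn n, C)) : schwartzOp 0 0 0 f = f := by
  ext x
  simp [schwartzOp_apply]

/-- `schwartzOp` as a bijection of `S^C(ℝⁿ)`. -/
noncomputable def schwartzEquiv (a b : Rn n) (c : ℝ) : 𝓢(Rn n, C) ≃ₗ[ℂ] 𝓢(Rn n, C) :=
  LinearEquiv.ofLinearMap (schwartzOp a b c) (schwartzOp (-a) (-b) (-c - inner ℝ a b))
    (by
      ext1 f
      have h : c + (-c - inner ℝ a b) + inner ℝ a b = 0 := by ring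
      simp [schwartzOp_comp, schwartzOp_zero, h])
    (by
      ext1 f
      have h : -c - inner ℝ a b + c + inner ℝ a b = 0 := by ring
      simp [schwartzOp_comp, schwartzOp_zero, h])

lemma norm_toE_schwartzOp (a b : Rn n) (c : ℝ) (f : 𝓢(Rn n, C)) :
    ‖toE n C (schwartzOp a b c f)‖ = ‖toE n C f‖ := by
  simp only [norm_toE]
  have : ∀ x, star (schwartzOp a b c f x) * schwartzOp a b c f x =
      (fun y => star (f y) * f y) (x - a) := by
    intro x
    rw [schwartzOp_apply]
    change star (phase b c x • f (x - a)) * (phase b c x • f (x - a)) = _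
    rw [star_smul, smul_mul_smul_comm, star_phase_mul_phase, one_smul]
  simp only [this]
  rw [integral_sub_right_eq_self (fun y => star (f y) * f y) a]

/-- The continuous extension to `E_n` of `f ↦ (x ↦ e^{ic} e^{i⟨b, x⟩} f(x - a))`. -/
noncomputable def weylOp (a b : Rn n) (c : ℝ) : E n C ≃ₗᵢ[ℂ] E n C :=
  (schwartzEquiv a b c).extendOfIsometry (toE n C) (toE n C) denseRange_toE denseRange_toE
    (norm_toE_schwartzOp a b c)

lemma weylOp_toE (a b : Rn n) (c : ℝ) (f : 𝓢(Rn n, C)) :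
    weylOp a b c (toE n C f) = toE n C (schwartzOp a b c f) :=
  LinearEquiv.extendOfIsometry_eq _ _ _ _ _ _ _

lemma weylOp_mul (a b a' b' : Rn n) (c c' : ℝ) :
    (weylOp a b c * weylOp a' b' c' : E n C ≃ₗᵢ[ℂ] E n C) =
      weylOp (a + a') (b + b') (c + c' - inner ℝ a b') := by
  refine LinearIsometryEquiv.ext fun u => ?_
  refine congrFun (denseRange_toE.equalizer (LinearIsometryEquiv.continuous _)
    (LinearIsometryEquiv.continuous _) (funext fun f => ?_)) u
  simp [weylOp_toE, schwartzOp_comp]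

variable (n C) in
/-- The canonical unitary representation of the Heisenberg group on `E_n`: the element with
coordinates `a`, `b`, `c` acts as `f ↦ (x ↦ e^{-ic} e^{i⟨b, x⟩} f(x - a))`. The sign of the central
character is the one that makes this multiplicative for the matrix group law. -/
noncomputable def heisenbergRep : Heisenberg n →* (E n C ≃ₗᵢ[ℂ] E n C) where
  toFun g := weylOp g.a g.b (-g.c)
  map_one' := by
    refine LinearIsometryEquiv.ext fun u => ?_
    refine congrFun (denseRange_toE.equalizer (LinearIsometryEquiv.continuous _)
      (LinearIsometryEquiv.continuous _) (funext fun f => ?_)) u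
    simp [weylOp_toE, schwartzOp_zero]
  map_mul' g h := by
    rw [weylOp_mul]
    congr 1
    simp only [Heisenberg.mul_c]
    ring

end Representation

/-- The smooth vectors of a family `V` of operators on a Banach space `X`, indexed by a Lie group
`G` modelled on `M`: the `x` for which `g ↦ V(g) x` is of class `C^∞` on the manifold `G`. -/
def smoothVectors (M : Type*) [NormedAddCommGroup M] [NormedSpace ℝ M]
    {G : Type*} [Group G] [TopologicalSpace G] [ChartedSpace M G] [LieGroup 𝓘(ℝ, M) ∞ G]
    {X : Type*} [NormedAddCommGroup X] [NormedSpace ℂ X] (V : G → X ≃ₗᵢ[ℂ] X) :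
    Submodule ℂ X where
  carrier := {x | ContMDiff 𝓘(ℝ, M) 𝓘(ℝ, X) ∞ fun g => V g x}
  zero_mem' := by simpa using contMDiff_const
  add_mem' {x y} hx hy := by
    have h : ContMDiff 𝓘(ℝ, M) 𝓘(ℝ, X) ∞ fun g => V g x + V g y := ContMDiff.add hx hy
    simpa using h
  smul_mem' z x hx := by
    have h : ContDiff ℝ ∞ fun y : X => z • y := contDiff_const_smul z
    have h' : ContMDiff 𝓘(ℝ, M) 𝓘(ℝ, X) ∞ fun g => z • V g x := h.contMDiff.comp hx
    simpa using h'

end HeisenbergSmooth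

/-! The central variable acts by a scalar exponential, so for either sign a vector is smooth exactly
when its orbit `weylOrbit` over phase space, with `c = 0`, is smooth (`mem_smoothVectors_iff`). On
phase space the operators multiply only up to a phase, and this cocycle drives every computation.

Schwartz functions are smooth: a weighted second order Taylor estimate gives the derivative of the
orbit at the origin, the cocycle carries it to every other point, and the resulting directional
derivatives are again orbits of Schwartz functions, up to smooth coefficients. Induction on the
order finishes (`isSmoothVec_toE`).

Conversely, let `u` be smooth and let `g` be a scalar Schwartz window. The short-time Fourier
transform `gabor g u` pairs `u` with the time-frequency shifts of `g`. Differentiating the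
commutation relation (`symplectic_smul_pairing`) shows that multiplying such a matrix coefficient by
a coordinate of phase space amounts to differentiating one of its two vectors. Since both are
smooth, this can be repeated, and the coefficient decays rapidly (`IsSmoothVec.pairing_decay`).
Superposing the shifts of `g` with rapidly decaying coefficients gives a Schwartz function
(`synthesisSchwartz`).

It remains to recover `u` from `gabor g u`. Pairing with Schwartz functions separates points of `E n
C`, so the inversion formula is only checked weakly. Fubini reduces it to the orthogonality
relation, which is Plancherel for Schwartz functions and follows for `u` by approximation. Only
Cauchy–Schwarz for the `C`-valued inner product is used; no bounded functional on the module has to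
be represented by a vector. -/

namespace HeisenbergSmooth

/-! ### The `C`-valued inner product on the completion, and unitarity of the Weyl operators. -/

section Pairing

variable {n : ℕ} {C : Type*} [CStarAlgebra C]

/-- Cauchy–Schwarz for the `C`-valued inner product. -/
lemma norm_preInner_le (f g : PreE n C) : ‖preInner f g‖ ≤ ‖f‖ * ‖g‖ := by
  let _ := CStarAlgebra.spectralOrder C
  let _ := CStarAlgebra.spectralOrderedRing C
  let _ : CStarModule Cᵐᵒᵖ (PreE n C) := PreE.cstarModule
  exact CStarModule.norm_inner_le (A := Cᵐᵒᵖ) (x := f) (y := g) (PreE n C)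

lemma norm_integral_star_mul_le (f g : 𝓢(Rn n, C)) :
    ‖∫ x, star (f x) * g x‖ ≤ ‖toE n C f‖ * ‖toE n C g‖ := by
  rw [norm_toE, norm_toE]
  exact norm_preInner_le (toPreE f) (toPreE g)

lemma integrable_star_mul_schwartz (f g : 𝓢(Rn n, C)) :
    Integrable fun x => star (f x) * g x :=
  integrable_star_mul (toPreE f) (toPreE g)

/-- The functional `g ↦ ∫ f(x)* g(x) dx` on Schwartz functions. -/
noncomputable def schwartzInner (f : 𝓢(Rn n, C)) : 𝓢(Rn n, C) →ₗ[ℂ] C where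
  toFun g := ∫ x, star (f x) * g x
  map_add' g h := by
    simp only [add_apply, mul_add]
    exact integral_add (integrable_star_mul_schwartz f g) (integrable_star_mul_schwartz f h)
  map_smul' z g := by
    simp only [smul_apply, mul_smul_comm]
    exact integral_smul z _

/-- The extension of `schwartzInner f` to `E_n`. -/
noncomputable def pairingLeft (f : 𝓢(Rn n, C)) : E n C →L[ℂ] C :=
  (schwartzInner f).extendOfNorm (toE n C)

lemma pairingLeft_toE (f g : 𝓢(Rn n, C)) :
    pairingLeft f (toE n C g) = ∫ x, star (f x) * g x :=
  LinearMap.extendOfNorm_eq denseRange_toE ⟨_, norm_integral_star_mul_le f⟩ g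

lemma norm_pairingLeft_le (f : 𝓢(Rn n, C)) : ‖pairingLeft f‖ ≤ ‖toE n C f‖ :=
  LinearMap.opNorm_extendOfNorm_le denseRange_toE (norm_nonneg _) (norm_integral_star_mul_le f)

lemma E_clm_ext {F : Type*} [NormedAddCommGroup F] [NormedSpace ℂ F] {σ : ℂ →+* ℂ}
    {S T : E n C →SL[σ] F} (h : ∀ f, S (toE n C f) = T (toE n C f)) : S = T :=
  ContinuousLinearMap.coeFn_injective <|
    denseRange_toE.equalizer S.continuous T.continuous (funext h)

variable (n C) in
/-- `pairingLeft` as a conjugate-linear map. -/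
noncomputable def pairingAux : 𝓢(Rn n, C) →ₛₗ[starRingEnd ℂ] (E n C →L[ℂ] C) where
  toFun := pairingLeft
  map_add' f g := E_clm_ext fun h => by
    simp only [add_apply, pairingLeft_toE, star_add,
      add_mul]
    exact integral_add (integrable_star_mul_schwartz f h) (integrable_star_mul_schwartz g h)
  map_smul' z f := E_clm_ext fun h => by
    simp only [smul_apply, pairingLeft_toE, star_smul,
      smul_mul_assoc]
    exact integral_smul _ _

variable (n C) in
/-- The `C`-valued inner product of `E_n`, conjugate-linear in the first variable. -/
noncomputable def pairing : E n C →L⋆[ℂ] E n C →L[ℂ] C :=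
  (pairingAux n C).extendOfNorm (toE n C)

lemma pairing_toE_left (f : 𝓢(Rn n, C)) : pairing n C (toE n C f) = pairingLeft f :=
  LinearMap.extendOfNorm_eq denseRange_toE
    ⟨1, fun f => by rw [one_mul]; exact norm_pairingLeft_le f⟩ f

lemma pairing_toE (f g : 𝓢(Rn n, C)) :
    pairing n C (toE n C f) (toE n C g) = ∫ x, star (f x) * g x := by
  rw [pairing_toE_left, pairingLeft_toE]

lemma norm_pairing_le (u v : E n C) : ‖pairing n C u v‖ ≤ ‖u‖ * ‖v‖ := by
  refine ((pairing n C u).le_opNorm v).trans ?_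
  gcongr
  have := LinearMap.norm_extendOfNorm_apply_le (f := pairingAux n C) denseRange_toE 1
    (fun f => by rw [one_mul]; exact norm_pairingLeft_le f) u
  rwa [one_mul] at this

lemma continuous_pairing : Continuous fun p : E n C × E n C => pairing n C p.1 p.2 :=
  (pairing n C).continuous.comp continuous_fst |>.clm_apply continuous_snd

lemma norm_pairing_toE_self (f : 𝓢(Rn n, C)) :
    ‖pairing n C (toE n C f) (toE n C f)‖ = ‖toE n C f‖ ^ 2 := by
  rw [pairing_toE, norm_toE, Real.sq_sqrt (norm_nonneg _)]

lemma exists_toE_norm_sub_lt (u : E n C) {ε : ℝ} (hε : 0 < ε) :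
    ∃ f, ‖u - toE n C f‖ < ε := by
  obtain ⟨f, hf⟩ := denseRange_toE.exists_dist_lt u hε
  exact ⟨f, by rwa [← dist_eq_norm]⟩

/-- The pairing with Schwartz functions separates the points of `E_n`. -/
lemma eq_zero_of_pairing_toE_eq_zero {w : E n C} (h : ∀ f, pairing n C (toE n C f) w = 0) :
    w = 0 := by
  rw [← norm_le_zero_iff]
  refine le_of_forall_pos_le_add fun ε hε => ?_
  obtain ⟨f, hf⟩ := exists_toE_norm_sub_lt w (half_pos hε)
  -- As `w` is orthogonal to `f`, the square of `f` is the pairing of `f` with `f - w`. Hence `f` is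
  -- no longer than its distance to `w`, which is arbitrarily small.
  have h1 : ‖toE n C f‖ ^ 2 ≤ ‖toE n C f‖ * ‖w - toE n C f‖ := by
    rw [← norm_pairing_toE_self]
    have : pairing n C (toE n C f) (toE n C f) = - pairing n C (toE n C f) (w - toE n C f) := by
      rw [map_sub, h f]; simp
    rw [this, norm_neg]
    exact norm_pairing_le _ _
  have h2 : ‖toE n C f‖ ≤ ‖w - toE n C f‖ := by
    rcases (norm_nonneg (toE n C f)).eq_or_lt with h0 | h0
    · rw [← h0]; exact norm_nonneg _
    · exact le_of_mul_le_mul_left (by rwa [← sq]) h0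
  have h3 : ‖w‖ ≤ ‖w - toE n C f‖ + ‖toE n C f‖ := by
    simpa using norm_add_le (w - toE n C f) (toE n C f)
  linarith

/-- The Weyl operators are unitary. -/
lemma pairing_weylOp (a b : Rn n) (c : ℝ) (u v : E n C) :
    pairing n C (weylOp a b c u) (weylOp a b c v) = pairing n C u v := by
  refine congrFun ((denseRange_toE.prodMap denseRange_toE).equalizer
    (g := fun p : E n C × E n C => pairing n C (weylOp a b c p.1) (weylOp a b c p.2))
    (h := fun p : E n C × E n C => pairing n C p.1 p.2)
    (continuous_pairing.comp (((weylOp a b c).continuous.comp continuous_fst).prodMk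
      ((weylOp a b c).continuous.comp continuous_snd))) continuous_pairing (funext fun p => ?_)) (u, v)
  simp only [Function.comp_apply, Prod.map_fst, Prod.map_snd, weylOp_toE, pairing_toE]
  have : ∀ x, star (schwartzOp a b c p.1 x) * schwartzOp a b c p.2 x =
      (fun y => star (p.1 y) * p.2 y) (x - a) := by
    intro x
    rw [schwartzOp_apply, schwartzOp_apply]
    change star (phase b c x • p.1 (x - a)) * (phase b c x • p.2 (x - a)) = _
    rw [star_smul, smul_mul_smul_comm, star_phase_mul_phase, one_smul]
  simp only [this]
  rw [integral_sub_right_eq_self (fun y => star (p.1 y) * p.2 y) a]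

lemma weylOp_apply_weylOp (a b a' b' : Rn n) (c c' : ℝ) (u : E n C) :
    weylOp a b c (weylOp a' b' c' u) = weylOp (a + a') (b + b') (c + c' - inner ℝ a b') u :=
  congrArg (fun T : E n C ≃ₗᵢ[ℂ] E n C => T u) (weylOp_mul a b a' b' c c')

lemma weylOp_eq_smul (a b : Rn n) (c : ℝ) (u : E n C) :
    weylOp a b c u = Complex.exp (Complex.I * c) • weylOp a b 0 u := by
  refine congrFun (denseRange_toE.equalizer (LinearIsometryEquiv.continuous _)
    (g := weylOp a b c) (h := fun u => Complex.exp (Complex.I * c) • weylOp a b 0 u)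
    ((weylOp a b 0).continuous.const_smul (Complex.exp (Complex.I * c))) (funext fun f => ?_)) u
  simp only [Function.comp_apply, weylOp_toE, ← map_smul]
  congr 1
  ext x
  simp [schwartzOp_apply, mul_smul]

lemma weylOp_zero (u : E n C) : weylOp 0 0 0 u = u := by
  refine congrFun (denseRange_toE.equalizer (g := weylOp (0 : Rn n) 0 0)
    (LinearIsometryEquiv.continuous _) continuous_id (funext fun f => ?_)) u
  simp [weylOp_toE, schwartzOp_zero]

end Pairing

/-! ### Smooth vectors on phase space and the decay of their matrix coefficients. -/

section SmoothVectors

variable {n : ℕ} {C : Type*} [CStarAlgebra C]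

lemma isBoundedBilinearMap_pairing :
    IsBoundedBilinearMap ℝ fun p : E n C × E n C => pairing n C p.1 p.2 where
  add_left x y z := by simp
  smul_left r x y := by
    change pairing n C ((r : ℂ) • x) y = (r : ℂ) • pairing n C x y
    rw [map_smulₛₗ, Complex.conj_ofReal, smul_apply]
  add_right x y z := by simp
  smul_right r x y := by
    change pairing n C x ((r : ℂ) • y) = (r : ℂ) • pairing n C x y
    simp
  bound := ⟨1, one_pos, fun x y => by rw [one_mul]; exact norm_pairing_le x y⟩

/-- The orbit map of `u` under the Weyl operators, on phase space. -/
noncomputable def weylOrbit (u : E n C) (p : Rn n × Rn n) : E n C := weylOp p.1 p.2 0 u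

/-- The vectors with smooth orbit map. -/
def IsSmoothVec (u : E n C) : Prop := ContDiff ℝ ∞ (weylOrbit u)

lemma weylOrbit_zero (u : E n C) : weylOrbit u 0 = u := weylOp_zero u

lemma norm_weylOrbit (u : E n C) (p : Rn n × Rn n) : ‖weylOrbit u p‖ = ‖u‖ :=
  LinearIsometryEquiv.norm_map _ _

/-- The cocycle: with the central coordinate fixed at zero the operators form only a projective
representation, and the discrepancy is this explicit phase. -/
lemma weylOp_weylOrbit (u : E n C) (p q : Rn n × Rn n) :
    weylOp p.1 p.2 0 (weylOrbit u q) =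
      Complex.exp (Complex.I * ((-inner ℝ p.1 q.2 : ℝ) : ℂ)) • weylOrbit u (p + q) := by
  rw [weylOrbit, weylOp_apply_weylOp, weylOp_eq_smul]
  simp [weylOrbit]

/-- The derivative of the representation in the direction `q`. -/
noncomputable def dWeyl (q : Rn n × Rn n) (u : E n C) : E n C := fderiv ℝ (weylOrbit u) 0 q

variable {u g : E n C}

lemma IsSmoothVec.differentiable (hu : IsSmoothVec u) : Differentiable ℝ (weylOrbit u) :=
  ContDiff.differentiable hu (by simp)

lemma IsSmoothVec.hasDerivAt_add_smul (hu : IsSmoothVec u) (p q : Rn n × Rn n) :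
    HasDerivAt (fun t : ℝ => weylOrbit u (p + t • q)) (fderiv ℝ (weylOrbit u) p q) 0 := by
  have h1 : HasDerivAt (fun t : ℝ => p + t • q) q 0 := by
    simpa using ((hasDerivAt_id (0 : ℝ)).smul_const q).const_add p
  have h2 : HasFDerivAt (weylOrbit u) (fderiv ℝ (weylOrbit u) p) (p + (0 : ℝ) • q) := by
    simpa using (hu.differentiable p).hasFDerivAt
  exact h2.comp_hasDerivAt (0 : ℝ) h1

lemma IsSmoothVec.hasDerivAt_dWeyl (hu : IsSmoothVec u) (q : Rn n × Rn n) :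
    HasDerivAt (fun t : ℝ => weylOrbit u (t • q)) (dWeyl q u) 0 := by
  simpa [dWeyl] using hu.hasDerivAt_add_smul 0 q

lemma hasDerivAt_exp_mul_I (s : ℝ) :
    HasDerivAt (fun t : ℝ => Complex.exp (Complex.I * ((t * s : ℝ) : ℂ))) (Complex.I * s) 0 := by
  have h1 : HasDerivAt (fun t : ℝ => Complex.I * ((t * s : ℝ) : ℂ)) (Complex.I * s) 0 := by
    have : HasDerivAt (fun t : ℝ => t * s) s 0 := by
      simpa using (hasDerivAt_id (0 : ℝ)).mul_const s
    exact this.ofReal_comp.const_mul Complex.I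
  simpa using h1.cexp

lemma hasDerivAt_weylOp (a b : Rn n) (c : ℝ) {f : ℝ → E n C} {f' : E n C}
    (hf : HasDerivAt f f' 0) :
    HasDerivAt (fun t => weylOp a b c (f t)) (weylOp a b c f') 0 :=
  (((weylOp a b c : E n C ≃ₗᵢ[ℂ] E n C).toContinuousLinearEquiv :
    E n C →L[ℂ] E n C).restrictScalars ℝ).hasFDerivAt.comp_hasDerivAt (0 : ℝ) hf

lemma hasDerivAt_exp_smul (s : ℝ) {f : ℝ → E n C} {f' : E n C} (hf : HasDerivAt f f' 0) :
    HasDerivAt (fun t : ℝ => Complex.exp (Complex.I * ((t * s : ℝ) : ℂ)) • f t)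
      (f' + (Complex.I * s) • f 0) 0 := by
  simpa [Pi.smul_def'] using (hasDerivAt_exp_mul_I s).smul hf

/-- Obtained by differentiating the cocycle identity along `t • q` at `t = 0`, once on each side.
The right-hand side is visibly smooth in `p`, so `dWeyl q` preserves smooth vectors and can be
iterated. -/
lemma IsSmoothVec.weylOrbit_dWeyl (hu : IsSmoothVec u) (p q : Rn n × Rn n) :
    weylOrbit (dWeyl q u) p = fderiv ℝ (weylOrbit u) p q +
      (Complex.I * ((-inner ℝ p.1 q.2 : ℝ) : ℂ)) • weylOrbit u p := by
  have h1 := hasDerivAt_weylOp p.1 p.2 0 (hu.hasDerivAt_dWeyl q)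
  have h2 := hasDerivAt_exp_smul (-inner ℝ p.1 q.2) (hu.hasDerivAt_add_smul p q)
  have h3 : (fun t : ℝ => weylOp p.1 p.2 0 (weylOrbit u (t • q))) = fun t : ℝ =>
      Complex.exp (Complex.I * ((t * -inner ℝ p.1 q.2 : ℝ) : ℂ)) • weylOrbit u (p + t • q) := by
    ext1 t
    rw [weylOp_weylOrbit]
    simp [inner_smul_right]
  rw [h3] at h1
  simpa [weylOrbit] using h1.unique h2

lemma IsSmoothVec.dWeyl (hu : IsSmoothVec u) (q : Rn n × Rn n) : IsSmoothVec (dWeyl q u) := by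
  have h : weylOrbit (HeisenbergSmooth.dWeyl q u) = fun p => fderiv ℝ (weylOrbit u) p q +
      (Complex.I * ((-inner ℝ p.1 q.2 : ℝ) : ℂ)) • weylOrbit u p :=
    funext fun p => hu.weylOrbit_dWeyl p q
  have h1 : ContDiff ℝ ∞ fun p => fderiv ℝ (weylOrbit u) p q :=
    (ContDiff.fderiv_right hu (by simp)).clm_apply contDiff_const
  have h2 : ContDiff ℝ ∞ fun p : Rn n × Rn n => (-inner ℝ p.1 q.2 : ℝ) :=
    (ContDiff.inner ℝ contDiff_fst contDiff_const).neg
  rw [IsSmoothVec, h]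
  exact h1.add ((contDiff_const.mul (Complex.ofRealCLM.contDiff.comp h2)).smul hu)

/-- The commutation relation in terms of matrix coefficients. -/
lemma symplectic_smul_pairing (hg : IsSmoothVec g) (hu : IsSmoothVec u) (p q : Rn n × Rn n) :
    (Complex.I * ((inner ℝ p.1 q.2 - inner ℝ q.1 p.2 : ℝ) : ℂ)) • pairing n C (weylOrbit g p) u =
      pairing n C (weylOrbit (dWeyl q g) p) u + pairing n C (weylOrbit g p) (dWeyl q u) := by
  -- Applying the cocycle in both orders, exchanging the operators at `t • q` and at `p` costs a
  -- phase linear in `t`, whose rate is the symplectic form of `p` and `q`.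
  have h1 : HasDerivAt (fun t : ℝ => weylOp (t • q).1 (t • q).2 0 (weylOrbit g p))
      (weylOrbit (dWeyl q g) p +
        (Complex.I * ((inner ℝ p.1 q.2 - inner ℝ q.1 p.2 : ℝ) : ℂ)) • weylOrbit g p) 0 := by
    have h2 := hasDerivAt_exp_smul (inner ℝ p.1 q.2 - inner ℝ q.1 p.2)
      (hasDerivAt_weylOp p.1 p.2 0 (hg.hasDerivAt_dWeyl q))
    have h3 : (fun t : ℝ => weylOp (t • q).1 (t • q).2 0 (weylOrbit g p)) = fun t : ℝ =>
        Complex.exp (Complex.I * ((t * (inner ℝ p.1 q.2 - inner ℝ q.1 p.2) : ℝ) : ℂ)) •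
          weylOp p.1 p.2 0 (weylOrbit g (t • q)) := by
      ext1 t
      rw [weylOp_weylOrbit, weylOp_weylOrbit, smul_smul, ← Complex.exp_add, add_comm p]
      congr 2
      simp [inner_smul_right, inner_smul_left]
      ring
    rw [h3]
    simpa [weylOrbit, weylOp_zero] using h2
  have h4 := (isBoundedBilinearMap_pairing.hasFDerivAt
    (weylOp ((0 : ℝ) • q).1 ((0 : ℝ) • q).2 0 (weylOrbit g p),
      weylOrbit u ((0 : ℝ) • q))).comp_hasDerivAt (0 : ℝ) (h1.prodMk (hu.hasDerivAt_dWeyl q))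
  have h5 : (fun t : ℝ => pairing n C (weylOp (t • q).1 (t • q).2 0 (weylOrbit g p))
      (weylOrbit u (t • q))) = fun _ => pairing n C (weylOrbit g p) u :=
    -- Both arguments are moved by the same unitary, so the pairing is constant in `t` and the
    -- product rule for it sums to zero.
    funext fun t => pairing_weylOp _ _ _ _ _
  have h6 := h4.unique (h5 ▸ hasDerivAt_const (0 : ℝ) (pairing n C (weylOrbit g p) u))
  simp only [IsBoundedBilinearMap.deriv_apply, zero_smul, Prod.fst_zero, Prod.snd_zero, weylOp_zero,
    weylOrbit_zero, map_add, map_smulₛₗ, add_apply, smul_apply] at h6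
  -- The pairing is conjugate-linear on the left, so the factor `I` comes out with the opposite
  -- sign.
  simp only [map_mul, Complex.conj_I, Complex.conj_ofReal, neg_mul, neg_smul] at h6
  rw [← sub_eq_zero, ← neg_eq_zero, ← h6]
  abel

lemma norm_le_sum_coord (a : Rn n) : ‖a‖ ≤ ∑ i, |a i| := by
  have h := (EuclideanSpace.basisFun (Fin n) ℝ).sum_repr a
  calc ‖a‖ = ‖∑ i, a i • (EuclideanSpace.basisFun (Fin n) ℝ) i‖ := by
        conv_lhs => rw [← h]
        simp
    _ ≤ ∑ i, ‖a i • (EuclideanSpace.basisFun (Fin n) ℝ) i‖ := norm_sum_le _ _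
    _ = ∑ i, |a i| := by simp [norm_smul]

/-- Matrix coefficients of smooth vectors decay rapidly. -/
lemma IsSmoothVec.pairing_decay (k : ℕ) (hg : IsSmoothVec g) (hu : IsSmoothVec u) :
    ∃ M, ∀ p, ‖p‖ ^ k * ‖pairing n C (weylOrbit g p) u‖ ≤ M := by
  induction k generalizing g u with
  | zero =>
    refine ⟨‖g‖ * ‖u‖, fun p => ?_⟩
    rw [pow_zero, one_mul, ← norm_weylOrbit g p]
    exact norm_pairing_le _ _
  | succ k ih =>
    -- One factor of the symplectic form is traded for a derivative falling on `g` or on `u`. This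
    -- is why the induction hypothesis must range over all pairs of smooth vectors.
    have key : ∀ q : Rn n × Rn n, ∃ M, ∀ p : Rn n × Rn n, ‖p‖ ^ k *
        (|inner ℝ p.1 q.2 - inner ℝ q.1 p.2| * ‖pairing n C (weylOrbit g p) u‖) ≤ M := by
      intro q
      obtain ⟨M₁, h₁⟩ := ih (hg.dWeyl q) hu
      obtain ⟨M₂, h₂⟩ := ih hg (hu.dWeyl q)
      refine ⟨M₁ + M₂, fun p => le_trans ?_ (add_le_add (h₁ p) (h₂ p))⟩
      rw [← mul_add]
      gcongr
      refine le_trans (le_of_eq ?_) (norm_add_le _ _)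
      rw [← symplectic_smul_pairing hg hu p q, norm_smul, norm_mul, Complex.norm_I, one_mul, Complex.norm_real,
        Real.norm_eq_abs]
    choose M hM using key
    -- The form against `(0, eᵢ)` reads off the coordinate `p.1 i`, and against `(eᵢ, 0)` the
    -- coordinate `p.2 i` up to sign. Together these bound the norm of `p`.
    refine ⟨∑ i, M (0, EuclideanSpace.single i 1) + ∑ i, M (EuclideanSpace.single i 1, 0),
      fun p => ?_⟩
    have hp : ‖p‖ ≤ ∑ i, |p.1 i| + ∑ i, |p.2 i| := by
      rw [Prod.norm_def]
      exact max_le ((norm_le_sum_coord _).trans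
        (le_add_of_nonneg_right (Finset.sum_nonneg fun i _ => abs_nonneg _)))
        ((norm_le_sum_coord _).trans
        (le_add_of_nonneg_left (Finset.sum_nonneg fun i _ => abs_nonneg _)))
    calc ‖p‖ ^ (k + 1) * ‖pairing n C (weylOrbit g p) u‖
        = ‖p‖ * (‖p‖ ^ k * ‖pairing n C (weylOrbit g p) u‖) := by ring
      _ ≤ (∑ i, |p.1 i| + ∑ i, |p.2 i|) * (‖p‖ ^ k * ‖pairing n C (weylOrbit g p) u‖) := by
        gcongr
      _ = ∑ i, ‖p‖ ^ k * (|p.1 i| * ‖pairing n C (weylOrbit g p) u‖) +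
          ∑ i, ‖p‖ ^ k * (|p.2 i| * ‖pairing n C (weylOrbit g p) u‖) := by
        rw [add_mul, Finset.sum_mul, Finset.sum_mul]
        congr 1 <;> exact Finset.sum_congr rfl fun i _ => by ring
      _ ≤ _ := by
        refine add_le_add (Finset.sum_le_sum fun i _ => ?_) (Finset.sum_le_sum fun i _ => ?_)
        · simpa [EuclideanSpace.inner_single_right] using hM (0, EuclideanSpace.single i 1) p
        · simpa [EuclideanSpace.inner_single_left] using hM (EuclideanSpace.single i 1, 0) p

lemma IsSmoothVec.continuous_pairing (u : E n C) (hg : IsSmoothVec g) :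
    Continuous fun p => pairing n C (weylOrbit g p) u :=
  HeisenbergSmooth.continuous_pairing.comp
    ((ContDiff.continuous hg).prodMk (continuous_const (y := u)))

/-- Smoothness with any central phase amounts to smoothness of the orbit map on phase space. -/
lemma mem_smoothVectors_iff {ε : ℝ} (u : E n C) :
    u ∈ smoothVectors (Rn n × Rn n × ℝ)
      (fun g : Heisenberg n => (weylOp g.a g.b (ε * g.c) : E n C ≃ₗᵢ[ℂ] E n C)) ↔
    IsSmoothVec u := by
  refine (contMDiff_iff_contDiff (𝕜 := ℝ)
    (f := fun g : Rn n × Rn n × ℝ => weylOp g.1 g.2.1 (ε * g.2.2) u)).trans ?_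
  constructor
  · intro h
    have h1 : ContDiff ℝ ∞ fun p : Rn n × Rn n => ((p.1, p.2, 0) : Rn n × Rn n × ℝ) := by fun_prop
    have h2 : weylOrbit u = (fun g : Rn n × Rn n × ℝ => weylOp g.1 g.2.1 (ε * g.2.2) u) ∘
        fun p : Rn n × Rn n => (p.1, p.2, 0) := by
      ext1 p
      simp [weylOrbit]
    rw [IsSmoothVec, h2]
    exact h.comp h1
  · intro h
    have h1 : ContDiff ℝ ∞ fun p : Rn n × Rn n × ℝ => (p.1, p.2.1) := by fun_prop
    have h2 : ContDiff ℝ ∞ fun p : Rn n × Rn n × ℝ =>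
        Complex.exp (Complex.I * ((ε * p.2.2 : ℝ) : ℂ)) := by
      have : ContDiff ℝ ∞ fun p : Rn n × Rn n × ℝ => ε * p.2.2 := by fun_prop
      exact (contDiff_const.mul (Complex.ofRealCLM.contDiff.comp this)).cexp
    convert! h2.smul (ContDiff.comp h h1) using 1
    ext1 p
    exact weylOp_eq_smul _ _ _ _

end SmoothVectors

/-! ### Schwartz functions are smooth vectors. -/

section SchwartzSmooth

variable {n : ℕ} {C : Type*} [CStarAlgebra C]

lemma exists_one_add_norm_pow_mul_le {V F : Type*} [NormedAddCommGroup V] [NormedSpace ℝ V]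
    [NormedAddCommGroup F] [NormedSpace ℝ F] (f : 𝓢(V, F)) (N : ℕ) :
    ∃ M, 0 ≤ M ∧ ∀ x, (1 + ‖x‖) ^ N * ‖f x‖ ≤ M := by
  refine ⟨2 ^ N * (Finset.Iic (N, 0)).sup (fun m => SchwartzMap.seminorm ℝ m.1 m.2) f,
    by positivity, fun x => ?_⟩
  simpa using SchwartzMap.one_add_le_sup_seminorm_apply (𝕜 := ℝ) (m := (N, 0)) le_rfl le_rfl f x

/-- Second order Taylor bound for a Schwartz function, with weights. -/
lemma exists_taylor_bound {V F : Type*} [NormedAddCommGroup V] [NormedSpace ℝ V]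
    [NormedAddCommGroup F] [NormedSpace ℝ F] (f : 𝓢(V, F)) (N : ℕ) :
    ∃ M, 0 ≤ M ∧ ∀ v x, ‖v‖ ≤ 1 →
      (1 + ‖x‖) ^ N * ‖f (x - v) - f x + fderiv ℝ f x v‖ ≤ M * ‖v‖ ^ 2 := by
  obtain ⟨M, hM0, hM⟩ := exists_one_add_norm_pow_mul_le
    (SchwartzMap.fderivCLM ℝ V (V →L[ℝ] F) (SchwartzMap.fderivCLM ℝ V F f)) N
  refine ⟨2 ^ N * M, by positivity, fun v x hv => ?_⟩
  -- `B` will bound the second derivative on the ball of radius `‖v‖ ≤ 1` about `x`; there the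
  -- weights at `x` and at `y` differ by a factor of at most `2 ^ N`.
  set B := 2 ^ N * M / (1 + ‖x‖) ^ N with hB
  have hx : 0 < (1 + ‖x‖) ^ N := by positivity
  have hball : ∀ y ∈ Metric.closedBall x ‖v‖, ‖fderiv ℝ (fderiv ℝ f) y‖ ≤ B := by
    intro y hy
    rw [hB, le_div_iff₀ hx]
    have hxy : 1 + ‖x‖ ≤ 2 * (1 + ‖y‖) := by
      have h1 : ‖x‖ ≤ ‖y‖ + ‖y - x‖ := by
        rw [norm_sub_rev]
        simpa using norm_add_le y (x - y)
      have h2 : ‖y - x‖ ≤ ‖v‖ := by simpa [dist_eq_norm] using hy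
      have := norm_nonneg y
      linarith
    calc ‖fderiv ℝ (fderiv ℝ f) y‖ * (1 + ‖x‖) ^ N
        ≤ ‖fderiv ℝ (fderiv ℝ f) y‖ * (2 * (1 + ‖y‖)) ^ N := by gcongr
      _ = 2 ^ N * ((1 + ‖y‖) ^ N * ‖fderiv ℝ (fderiv ℝ f) y‖) := by rw [mul_pow]; ring
      _ ≤ 2 ^ N * M := by gcongr; exact hM y
  have hd1 : ∀ y, HasFDerivAt f (fderiv ℝ f y) y := fun y => f.differentiableAt.hasFDerivAt
  have hd2 : ∀ y, HasFDerivAt (fderiv ℝ f) (fderiv ℝ (fderiv ℝ f) y) y := fun y =>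
    (SchwartzMap.fderivCLM ℝ V F f).differentiableAt.hasFDerivAt
  have hconv : Convex ℝ (Metric.closedBall x ‖v‖) := convex_closedBall _ _
  have hxm : x ∈ Metric.closedBall x ‖v‖ := Metric.mem_closedBall_self (norm_nonneg _)
  have hvm : x - v ∈ Metric.closedBall x ‖v‖ := by simp
  have hB0 : 0 ≤ B := by positivity
  have h1 : ∀ y ∈ Metric.closedBall x ‖v‖, ‖fderiv ℝ f y - fderiv ℝ f x‖ ≤ B * ‖v‖ := by
    intro y hy
    refine (hconv.norm_image_sub_le_of_norm_hasFDerivWithin_le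
      (fun z _ => (hd2 z).hasFDerivWithinAt) hball hxm hy).trans ?_
    gcongr
    simpa [dist_eq_norm] using hy
  -- The mean value inequality for `f` minus its linear part at `x`, whose derivative is at most `B
  -- * ‖v‖` on the ball.
  have h2 := hconv.norm_image_sub_le_of_norm_hasFDerivWithin_le'
      (fun z _ => (hd1 z).hasFDerivWithinAt) h1 hxm hvm
  have h3 : f (x - v) - f x - fderiv ℝ f x (x - v - x) = f (x - v) - f x + fderiv ℝ f x v := by
    simp
  rw [h3] at h2
  calc (1 + ‖x‖) ^ N * ‖f (x - v) - f x + fderiv ℝ f x v‖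
      ≤ (1 + ‖x‖) ^ N * (B * ‖v‖ * ‖x - v - x‖) := by gcongr
    _ = 2 ^ N * M * ‖v‖ ^ 2 := by
      rw [hB]
      simp only [sub_sub_cancel_left, norm_neg]
      field_simp

lemma integrable_one_add_norm_pow_inv :
    Integrable fun x : Rn n => ((1 + ‖x‖) ^ (n + 1))⁻¹ := by
  have := integrable_one_add_norm (E := Rn n) (μ := volume) (r := (n + 1 : ℕ)) (by simp)
  refine this.congr (Filter.Eventually.of_forall fun x => ?_)
  simp only
  rw [Real.rpow_neg (by positivity), Real.rpow_natCast]

variable (n C) in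
/-- The norm of `E_n` is controlled by a weighted supremum norm. -/
lemma exists_norm_toE_le :
    ∃ K, 0 ≤ K ∧ ∀ (f : 𝓢(Rn n, C)) (M : ℝ), 0 ≤ M →
      (∀ x, (1 + ‖x‖) ^ (n + 1) * ‖f x‖ ≤ M) → ‖toE n C f‖ ≤ K * M := by
  refine ⟨√(∫ x : Rn n, ((1 + ‖x‖) ^ (n + 1))⁻¹), Real.sqrt_nonneg _, fun f M hM h => ?_⟩
  rw [norm_toE, ← Real.sqrt_sq hM, ← Real.sqrt_mul (integral_nonneg fun x => by positivity)]
  refine Real.sqrt_le_sqrt ?_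
  rw [← integral_mul_const]
  refine norm_integral_le_of_norm_le (integrable_one_add_norm_pow_inv.mul_const _)
    (Filter.Eventually.of_forall fun x => ?_)
  have h1 : 1 ≤ (1 + ‖x‖) ^ (n + 1) := one_le_pow₀ (by simp)
  have h0 : 0 < (1 + ‖x‖) ^ (n + 1) := by positivity
  rw [CStarRing.norm_star_mul_self, inv_mul_eq_div, le_div_iff₀ h0]
  calc ‖f x‖ * ‖f x‖ * (1 + ‖x‖) ^ (n + 1)
      ≤ ‖f x‖ * ‖f x‖ * (1 + ‖x‖) ^ (n + 1) * (1 + ‖x‖) ^ (n + 1) :=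
        le_mul_of_one_le_right (by positivity) h1
    _ = ((1 + ‖x‖) ^ (n + 1) * ‖f x‖) ^ 2 := by ring
    _ ≤ M ^ 2 := by gcongr; exact h x

lemma hasTemperateGrowth_I_mul_inner (w : Rn n) :
    (fun x : Rn n => Complex.I * ((inner ℝ w x : ℝ) : ℂ)).HasTemperateGrowth :=
  (Function.HasTemperateGrowth.const Complex.I).mul
    (Complex.ofRealCLM.hasTemperateGrowth.comp (Function.hasTemperateGrowth_inner_right w))

/-- The derived representation on Schwartz functions. -/
noncomputable def dSchwartz (q : Rn n × Rn n) (f : 𝓢(Rn n, C)) : 𝓢(Rn n, C) :=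
  SchwartzMap.smulLeftCLM C (fun x : Rn n => Complex.I * ((inner ℝ q.2 x : ℝ) : ℂ)) f -
    LineDeriv.lineDerivOp q.1 f

lemma dSchwartz_apply (q : Rn n × Rn n) (f : 𝓢(Rn n, C)) (x : Rn n) :
    dSchwartz q f x = (Complex.I * ((inner ℝ q.2 x : ℝ) : ℂ)) • f x - fderiv ℝ f x q.1 := by
  rw [dSchwartz, sub_apply, SchwartzMap.smulLeftCLM_apply_apply
    (hasTemperateGrowth_I_mul_inner q.2), SchwartzMap.lineDerivOp_apply_eq_fderiv]

/-- `dSchwartz`, as a linear map in the direction. -/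
noncomputable def dSchwartzCLM (f : 𝓢(Rn n, C)) : Rn n × Rn n →L[ℝ] E n C :=
  LinearMap.toContinuousLinearMap
    { toFun := fun q => toE n C (dSchwartz q f)
      map_add' := fun q r => by
        rw [← map_add]
        congr 1
        ext x
        simp only [dSchwartz_apply, add_apply, Prod.fst_add, Prod.snd_add, map_add, inner_add_left,
          Complex.ofReal_add, mul_add, add_smul]
        abel
      map_smul' := fun r q => by
        change toE n C _ = (r : ℂ) • toE n C _
        rw [← map_smul]
        congr 1
        ext x
        change _ = r • dSchwartz q f x
        simp only [dSchwartz_apply, Prod.smul_fst, Prod.smul_snd, map_smul, inner_smul_left,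
          smul_sub, conj_trivial, Complex.ofReal_mul]
        congr 1
        rw [mul_left_comm, mul_smul, Complex.coe_smul] }

lemma dSchwartzCLM_apply (f : 𝓢(Rn n, C)) (q : Rn n × Rn n) :
    dSchwartzCLM f q = toE n C (dSchwartz q f) := rfl

/-- The power series handles `|y| ≤ 1`; beyond that the triangle inequality gives `2 * |y|`, which
is at most `2 * |y| ^ 2`. The bound must hold for all `y`, because it is applied to `⟨b, x⟩`, which
is unbounded in `x` however small `b` is. -/
lemma norm_exp_I_mul_sub_one_sub_le (y : ℝ) :
    ‖Complex.exp (Complex.I * y) - 1 - Complex.I * y‖ ≤ 2 * |y| ^ 2 := by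
  rcases le_total |y| 1 with h | h
  · have h1 : ‖Complex.I * (y : ℂ)‖ = |y| := by simp
    have := Complex.norm_exp_sub_one_sub_id_le (x := Complex.I * y) (by rwa [h1])
    rw [h1] at this
    have h2 := sq_nonneg |y|
    linarith
  · have h1 : ‖Complex.exp (Complex.I * y) - 1‖ ≤ |y| := Real.norm_exp_I_mul_ofReal_sub_one_le
    have h2 := norm_sub_le (Complex.exp (Complex.I * y) - 1) (Complex.I * y)
    have h3 : ‖Complex.I * (y : ℂ)‖ = |y| := by simp
    rw [h3] at h2
    nlinarith

/-- The remainder splits into the Taylor error of the translation, that of the modulation, and a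
cross term. Each is quadratic in `q`; the modulation factors cost two and one powers of `‖x‖` in the
last two terms, which are paid for by the weights `N + 2` and `N + 1`. -/
lemma exists_schwartzOp_remainder_bound (f : 𝓢(Rn n, C)) (N : ℕ) :
    ∃ M, 0 ≤ M ∧ ∀ (q : Rn n × Rn n) (x : Rn n), ‖q‖ ≤ 1 →
      (1 + ‖x‖) ^ N * ‖(schwartzOp q.1 q.2 0 f - f - dSchwartz q f) x‖ ≤ M * ‖q‖ ^ 2 := by
  obtain ⟨M₁, h₁, H₁⟩ := exists_taylor_bound f N
  obtain ⟨M₂, h₂, H₂⟩ := exists_one_add_norm_pow_mul_le f (N + 2)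
  obtain ⟨M₃, h₃, H₃⟩ := exists_one_add_norm_pow_mul_le (SchwartzMap.fderivCLM ℝ _ _ f) (N + 1)
  refine ⟨M₁ + 2 * M₂ + M₃, by positivity, fun q x hq => ?_⟩
  have hv : ‖q.1‖ ≤ ‖q‖ := norm_fst_le q
  have hw : ‖q.2‖ ≤ ‖q‖ := norm_snd_le q
  set y : ℝ := inner ℝ q.2 x with hy
  have hy' : |y| ≤ ‖q.2‖ * ‖x‖ := abs_real_inner_le_norm _ _
  set e := Complex.exp (Complex.I * y) with he
  have hnorm : ‖e‖ = 1 := Complex.norm_exp_I_mul_ofReal y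
  have hsplit : (schwartzOp q.1 q.2 0 f - f - dSchwartz q f) x =
      e • (f (x - q.1) - f x + fderiv ℝ f x q.1) + (e - 1 - Complex.I * y) • f x -
        (e - 1) • fderiv ℝ f x q.1 := by
    simp only [sub_apply, schwartzOp_apply, dSchwartz_apply, ← hy]
    simp only [Complex.ofReal_zero, mul_zero, Complex.exp_zero, one_mul, ← he]
    module
  have hx1 : ‖x‖ ≤ 1 + ‖x‖ := by linarith
  have b1 : (1 + ‖x‖) ^ N * ‖e • (f (x - q.1) - f x + fderiv ℝ f x q.1)‖ ≤ M₁ * ‖q‖ ^ 2 := by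
    rw [norm_smul, hnorm, one_mul]
    refine (H₁ q.1 x (hv.trans hq)).trans ?_
    gcongr
  have b2 : (1 + ‖x‖) ^ N * ‖(e - 1 - Complex.I * y) • f x‖ ≤ 2 * M₂ * ‖q‖ ^ 2 := by
    rw [norm_smul]
    calc (1 + ‖x‖) ^ N * (‖e - 1 - Complex.I * y‖ * ‖f x‖)
        ≤ (1 + ‖x‖) ^ N * (2 * (‖q‖ * (1 + ‖x‖)) ^ 2 * ‖f x‖) := by
          gcongr
          refine (norm_exp_I_mul_sub_one_sub_le y).trans ?_
          have : |y| ≤ ‖q‖ * (1 + ‖x‖) := hy'.trans (by gcongr)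
          gcongr
      _ = 2 * ((1 + ‖x‖) ^ (N + 2) * ‖f x‖) * ‖q‖ ^ 2 := by ring
      _ ≤ 2 * M₂ * ‖q‖ ^ 2 := by gcongr; exact H₂ x
  have b3 : (1 + ‖x‖) ^ N * ‖(e - 1) • fderiv ℝ f x q.1‖ ≤ M₃ * ‖q‖ ^ 2 := by
    rw [norm_smul]
    calc (1 + ‖x‖) ^ N * (‖e - 1‖ * ‖fderiv ℝ f x q.1‖)
        ≤ (1 + ‖x‖) ^ N * ((‖q‖ * (1 + ‖x‖)) * (‖fderiv ℝ f x‖ * ‖q‖)) := by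
          gcongr
          · refine Real.norm_exp_I_mul_ofReal_sub_one_le.trans (hy'.trans ?_)
            gcongr
          · refine (ContinuousLinearMap.le_opNorm _ _).trans ?_
            gcongr
      _ = ((1 + ‖x‖) ^ (N + 1) * ‖fderiv ℝ f x‖) * ‖q‖ ^ 2 := by ring
      _ ≤ M₃ * ‖q‖ ^ 2 := by gcongr; exact H₃ x
  rw [hsplit]
  calc (1 + ‖x‖) ^ N * ‖e • (f (x - q.1) - f x + fderiv ℝ f x q.1) +
        (e - 1 - Complex.I * y) • f x - (e - 1) • fderiv ℝ f x q.1‖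
      ≤ (1 + ‖x‖) ^ N * (‖e • (f (x - q.1) - f x + fderiv ℝ f x q.1)‖ +
        ‖(e - 1 - Complex.I * y) • f x‖ + ‖(e - 1) • fderiv ℝ f x q.1‖) := by
        gcongr
        exact (norm_sub_le _ _).trans (by gcongr; exact norm_add_le _ _)
    _ ≤ (M₁ + 2 * M₂ + M₃) * ‖q‖ ^ 2 := by
      rw [mul_add, mul_add]
      linarith

/-- The weight `n + 1` turns the pointwise remainder estimate into one for the norm of `E n C`, and
an error of order `‖q‖ ^ 2` has zero derivative at the origin. -/
lemma hasFDerivAt_weylOrbit_toE_zero (f : 𝓢(Rn n, C)) :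
    HasFDerivAt (weylOrbit (toE n C f)) (dSchwartzCLM f) 0 := by
  obtain ⟨K, hK, H⟩ := exists_norm_toE_le n C
  obtain ⟨M, hM, HM⟩ := exists_schwartzOp_remainder_bound f (n + 1)
  have hO : (fun q => weylOrbit (toE n C f) q - toE n C f - dSchwartzCLM f q)
      =O[nhds 0] fun q : Rn n × Rn n => ‖q - 0‖ ^ 2 := by
    refine Asymptotics.IsBigO.of_bound (K * M) ?_
    filter_upwards [Metric.closedBall_mem_nhds (0 : Rn n × Rn n) one_pos] with q hq
    have hq : ‖q‖ ≤ 1 := by simpa using hq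
    rw [weylOrbit, weylOp_toE, dSchwartzCLM_apply, ← map_sub, ← map_sub, sub_zero, norm_pow,
      norm_norm, mul_assoc]
    exact H _ _ (by positivity) fun x => HM q x hq
  have h1 := hO.hasFDerivAt (𝕜 := ℝ) (by norm_num)
  have h2 := (h1.add (dSchwartzCLM f).hasFDerivAt).add_const (toE n C f)
  rw [zero_add] at h2
  refine h2.congr_of_eventuallyEq (Filter.Eventually.of_forall fun q => ?_)
  simp

lemma weylOrbit_add (u : E n C) (p q : Rn n × Rn n) :
    weylOrbit u (p + q) = Complex.exp (Complex.I * ((inner ℝ p.1 q.2 : ℝ) : ℂ)) •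
      weylOp p.1 p.2 0 (weylOrbit u q) := by
  rw [weylOp_weylOrbit, smul_smul, ← Complex.exp_add, ← mul_add, ← Complex.ofReal_add]
  simp

/-- The cocycle writes the orbit near `p` as a phase times a fixed isometry applied to the orbit
near the origin, so differentiability moves from the origin to `p`. -/
lemma exists_hasFDerivAt_weylOrbit_toE (f : 𝓢(Rn n, C)) (p : Rn n × Rn n) :
    ∃ D : Rn n × Rn n →L[ℝ] E n C, HasFDerivAt (weylOrbit (toE n C f)) D p ∧ ∀ q,
      D q = weylOrbit (toE n C (dSchwartz q f)) p +
        (Complex.I * ((inner ℝ p.1 q.2 : ℝ) : ℂ)) • weylOrbit (toE n C f) p := by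
  have h1 : HasFDerivAt (fun q => weylOp p.1 p.2 0 (weylOrbit (toE n C f) q))
      ((((weylOp p.1 p.2 0 : E n C ≃ₗᵢ[ℂ] E n C).toContinuousLinearEquiv :
        E n C →L[ℂ] E n C).restrictScalars ℝ).comp (dSchwartzCLM f)) 0 :=
    (((weylOp p.1 p.2 0 : E n C ≃ₗᵢ[ℂ] E n C).toContinuousLinearEquiv :
      E n C →L[ℂ] E n C).restrictScalars ℝ).hasFDerivAt.comp 0 (hasFDerivAt_weylOrbit_toE_zero f)
  let L : Rn n × Rn n →L[ℝ] ℂ :=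
    Complex.ofRealCLM.comp ((innerSL ℝ p.1).comp (ContinuousLinearMap.snd ℝ _ _))
  have hL : ∀ q, L q = ((inner ℝ p.1 q.2 : ℝ) : ℂ) := fun q => rfl
  have h0 : HasFDerivAt (fun q : Rn n × Rn n => ((inner ℝ p.1 q.2 : ℝ) : ℂ)) L 0 := L.hasFDerivAt
  have h2 := h0.const_mul Complex.I
  have h3 := h2.cexp.smul h1
  have h4 : HasFDerivAt (fun q => weylOrbit (toE n C f) (p + q)) _ 0 :=
    h3.congr_of_eventuallyEq (Filter.Eventually.of_forall fun q => weylOrbit_add _ _ _)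
  rw [hasFDerivAt_comp_add_left, add_zero] at h4
  refine ⟨_, h4, fun q => ?_⟩
  simp [weylOrbit, weylOp_zero, dSchwartzCLM_apply, hL]

/-- Each directional derivative of the orbit of `f` combines the orbits of `dSchwartz q f` and of
`f` with smooth scalar coefficients, so the induction closes over all Schwartz functions. -/
lemma contDiff_weylOrbit_toE (k : ℕ) (f : 𝓢(Rn n, C)) :
    ContDiff ℝ k (weylOrbit (toE n C f)) := by
  choose D hD hD' using fun f : 𝓢(Rn n, C) => exists_hasFDerivAt_weylOrbit_toE f
  induction k generalizing f with
  | zero =>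
    exact contDiff_zero.2 (continuous_iff_continuousAt.2 fun p => (hD f p).continuousAt)
  | succ k ih =>
    have hcast : ((k + 1 : ℕ) : ℕ∞ω) = (k : ℕ∞ω) + 1 := by push_cast; rfl
    rw [hcast, contDiff_succ_iff_fderiv_apply]
    -- The middle clause concerns analytic order `ω` and is vacuous for a natural number.
    refine ⟨fun p => (hD f p).differentiableAt, fun h => by simp at h, fun q => ?_⟩
    have h : (fun p => fderiv ℝ (weylOrbit (toE n C f)) p q) = fun p =>
        weylOrbit (toE n C (dSchwartz q f)) p +
        (Complex.I * ((inner ℝ p.1 q.2 : ℝ) : ℂ)) • weylOrbit (toE n C f) p := by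
      ext1 p
      rw [(hD f p).fderiv, hD']
    rw [h]
    have h2 : ContDiff ℝ k fun p : Rn n × Rn n => (inner ℝ p.1 q.2 : ℝ) :=
      ContDiff.inner ℝ contDiff_fst contDiff_const
    exact (ih _).add ((contDiff_const.mul (Complex.ofRealCLM.contDiff.comp h2)).smul (ih f))

/-- Schwartz functions are smooth vectors. -/
lemma isSmoothVec_toE (f : 𝓢(Rn n, C)) : IsSmoothVec (toE n C f) :=
  contDiff_infty.2 fun k => contDiff_weylOrbit_toE k f

end SchwartzSmooth

/-! ### Rapid decay of iterated derivatives, reduced to coordinate derivatives. -/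

section Decay

variable {V F G : Type*} [NormedAddCommGroup V] [NormedSpace ℝ V] [NormedAddCommGroup F]
  [NormedSpace ℝ F] [NormedAddCommGroup G] [NormedSpace ℝ G]

/-- The function is `C^m` and its `m`-th derivative decays rapidly. -/
def DecayingDeriv (m : ℕ) (f : V → F) : Prop :=
  ContDiff ℝ m f ∧ ∀ k : ℕ, ∃ M, ∀ x, ‖x‖ ^ k * ‖iteratedFDeriv ℝ m f x‖ ≤ M

lemma DecayingDeriv.add {m : ℕ} {f g : V → F} (hf : DecayingDeriv m f) (hg : DecayingDeriv m g) :
    DecayingDeriv m (fun x => f x + g x) := by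
  refine ⟨hf.1.add hg.1, fun k => ?_⟩
  obtain ⟨M₁, h₁⟩ := hf.2 k
  obtain ⟨M₂, h₂⟩ := hg.2 k
  refine ⟨M₁ + M₂, fun x => ?_⟩
  rw [show (fun x => f x + g x) = f + g from rfl,
    iteratedFDeriv_add_apply hf.1.contDiffAt hg.1.contDiffAt]
  calc ‖x‖ ^ k * ‖iteratedFDeriv ℝ m f x + iteratedFDeriv ℝ m g x‖
      ≤ ‖x‖ ^ k * (‖iteratedFDeriv ℝ m f x‖ + ‖iteratedFDeriv ℝ m g x‖) := by
        gcongr; exact norm_add_le _ _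
    _ ≤ M₁ + M₂ := by rw [mul_add]; exact add_le_add (h₁ x) (h₂ x)

lemma DecayingDeriv.zero (m : ℕ) : DecayingDeriv m (fun _ : V => (0 : F)) :=
  ⟨contDiff_const, fun k => ⟨0, fun x => by
    have : iteratedFDeriv ℝ m (fun _ : V => (0 : F)) = 0 := iteratedFDeriv_fun_zero
    simp [this]⟩⟩

lemma DecayingDeriv.sum {ι : Type*} (s : Finset ι) {m : ℕ} {f : ι → V → F}
    (hf : ∀ i, DecayingDeriv m (f i)) : DecayingDeriv m (fun x => ∑ i ∈ s, f i x) := by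
  classical
  induction s using Finset.induction_on with
  | empty => simpa using DecayingDeriv.zero m
  | insert i s hi ih => simpa only [Finset.sum_insert hi] using (hf i).add ih

lemma DecayingDeriv.clm_comp {m : ℕ} {f : V → F} (hf : DecayingDeriv m f) (L : F →L[ℝ] G) :
    DecayingDeriv m (fun x => L (f x)) := by
  refine ⟨L.contDiff.comp hf.1, fun k => ?_⟩
  obtain ⟨M, h⟩ := hf.2 k
  refine ⟨‖L‖ * M, fun x => ?_⟩
  calc ‖x‖ ^ k * ‖iteratedFDeriv ℝ m (L ∘ f) x‖
      ≤ ‖x‖ ^ k * (‖L‖ * ‖iteratedFDeriv ℝ m f x‖) := by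
        gcongr; exact L.norm_iteratedFDeriv_comp_left hf.1.contDiffAt le_rfl
    _ = ‖L‖ * (‖x‖ ^ k * ‖iteratedFDeriv ℝ m f x‖) := by ring
    _ ≤ ‖L‖ * M := by gcongr; exact h x

lemma DecayingDeriv.of_fderiv {m : ℕ} {f : V → F} (hf : Differentiable ℝ f)
    (h : DecayingDeriv m (fderiv ℝ f)) : DecayingDeriv (m + 1) f := by
  constructor
  · push_cast
    exact contDiff_succ_iff_fderiv.2 ⟨hf, fun h => by simp at h, h.1⟩
  · intro k
    obtain ⟨M, hM⟩ := h.2 k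
    exact ⟨M, fun x => by rw [← norm_iteratedFDeriv_fderiv]; exact hM x⟩

lemma fderiv_eq_sum_coord {n : ℕ} (D : Rn n →L[ℝ] F) :
    D = ∑ i, ContinuousLinearMap.smulRightL ℝ (Rn n) F (EuclideanSpace.proj i)
      (D (EuclideanSpace.single i 1)) := by
  refine ContinuousLinearMap.ext fun x => ?_
  conv_lhs => rw [← (EuclideanSpace.basisFun (Fin n) ℝ).sum_repr x]
  simp

/-- In finite dimension the derivative is a sum of fixed linear maps applied to its coordinate
values. Inductions on `m` can therefore stay among functions with the same codomain. -/
lemma DecayingDeriv.of_coord {n m : ℕ} {f : Rn n → F} (hf : Differentiable ℝ f)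
    (h : ∀ i, DecayingDeriv m (fun x => fderiv ℝ f x (EuclideanSpace.single i 1))) :
    DecayingDeriv (m + 1) f := by
  refine .of_fderiv hf ?_
  have : fderiv ℝ f = fun x => ∑ i, ContinuousLinearMap.smulRightL ℝ (Rn n) F
      (EuclideanSpace.proj i) (fderiv ℝ f x (EuclideanSpace.single i 1)) :=
    funext fun x => fderiv_eq_sum_coord _
  rw [this]
  exact .sum _ fun i => (h i).clm_comp _

end Decay

/-! ### Superpositions of time-frequency shifts with rapidly decaying coefficients are Schwartz. -/

section Synthesis

variable {n : ℕ} {C : Type*} [CStarAlgebra C]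

/-- Continuous functions decaying faster than every polynomial. -/
def RapidDecay {V F : Type*} [NormedAddCommGroup V] [NormedAddCommGroup F] (f : V → F) : Prop :=
  Continuous f ∧ ∀ k : ℕ, ∃ M, 0 ≤ M ∧ ∀ p, (1 + ‖p‖) ^ k * ‖f p‖ ≤ M

lemma rapidDecay_of_pow_mul_le {V F : Type*} [NormedAddCommGroup V] [NormedAddCommGroup F]
    {f : V → F} (hf : Continuous f) (h : ∀ k : ℕ, ∃ M, ∀ p, ‖p‖ ^ k * ‖f p‖ ≤ M) :
    RapidDecay f := by
  refine ⟨hf, fun k => ?_⟩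
  obtain ⟨M₀, h₀⟩ := h 0
  obtain ⟨M₁, h₁⟩ := h k
  refine ⟨max (2 ^ k * (M₀ + M₁)) 0, le_max_right _ _, fun p => le_max_of_le_left ?_⟩
  have h2 : (1 + ‖p‖) ^ k ≤ 2 ^ k * (1 + ‖p‖ ^ k) := by
    rcases le_total ‖p‖ 1 with hp | hp
    · calc (1 + ‖p‖) ^ k ≤ 2 ^ k := by gcongr; linarith
        _ ≤ 2 ^ k * (1 + ‖p‖ ^ k) := le_mul_of_one_le_right (by positivity) (by simp)
    · calc (1 + ‖p‖) ^ k ≤ (2 * ‖p‖) ^ k := by gcongr; linarith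
        _ = 2 ^ k * ‖p‖ ^ k := mul_pow _ _ _
        _ ≤ 2 ^ k * (1 + ‖p‖ ^ k) := by gcongr; simp
  calc (1 + ‖p‖) ^ k * ‖f p‖ ≤ 2 ^ k * (1 + ‖p‖ ^ k) * ‖f p‖ := by gcongr
    _ = 2 ^ k * (‖p‖ ^ 0 * ‖f p‖ + ‖p‖ ^ k * ‖f p‖) := by rw [pow_zero]; ring
    _ ≤ 2 ^ k * (M₀ + M₁) := by gcongr; exacts [h₀ p, h₁ p]

lemma RapidDecay.integrable_pow_mul {V F : Type*} [NormedAddCommGroup V] [NormedSpace ℝ V]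
    [FiniteDimensional ℝ V] [MeasureSpace V] [BorelSpace V]
    [(volume : Measure V).IsAddHaarMeasure] [NormedAddCommGroup F] {f : V → F} (hf : RapidDecay f)
    (k : ℕ) : Integrable fun p => (1 + ‖p‖) ^ k * ‖f p‖ := by
  -- The surplus of `dim V + 1` powers is what makes the majorant integrable.
  obtain ⟨M, -, hM⟩ := hf.2 (k + (Module.finrank ℝ V + 1))
  have h := (integrable_one_add_norm (E := V) (μ := volume)
    (r := (Module.finrank ℝ V + 1 : ℕ)) (by simp)).const_mul M
  refine h.mono' ?_ (Filter.Eventually.of_forall fun p => ?_)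
  · have := hf.1
    exact Continuous.aestronglyMeasurable (by fun_prop)
  · have h0 : 0 < (1 + ‖p‖) ^ (Module.finrank ℝ V + 1) := by positivity
    rw [Real.norm_of_nonneg (by positivity), Real.rpow_neg (by positivity), Real.rpow_natCast,
      ← div_eq_mul_inv, le_div_iff₀ h0]
    refine le_of_eq_of_le ?_ (hM p)
    ring

lemma RapidDecay.integrable {V F : Type*} [NormedAddCommGroup V] [NormedSpace ℝ V]
    [FiniteDimensional ℝ V] [MeasureSpace V] [BorelSpace V]
    [(volume : Measure V).IsAddHaarMeasure] [NormedAddCommGroup F] {f : V → F}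
    (hf : RapidDecay f) : Integrable f := by
  have h := hf.integrable_pow_mul 0
  simp only [pow_zero, one_mul] at h
  exact (integrable_norm_iff hf.1.aestronglyMeasurable).1 h

/-- Differentiating a modulation brings down a factor linear in the frequency; admissible
coefficients absorb it. -/
lemma RapidDecay.smul_coord {F : Rn n × Rn n → C} (hF : RapidDecay F) (v : Rn n) :
    RapidDecay fun p => (Complex.I * ((inner ℝ p.2 v : ℝ) : ℂ)) • F p := by
  refine ⟨?_, fun k => ?_⟩
  · have := hF.1
    fun_prop
  · obtain ⟨M, hM0, hM⟩ := hF.2 (k + 1)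
    refine ⟨‖v‖ * M, by positivity, fun p => ?_⟩
    rw [norm_smul, norm_mul, Complex.norm_I, one_mul, Complex.norm_real, Real.norm_eq_abs]
    calc (1 + ‖p‖) ^ k * (|inner ℝ p.2 v| * ‖F p‖)
        ≤ (1 + ‖p‖) ^ k * (((1 + ‖p‖) * ‖v‖) * ‖F p‖) := by
          gcongr
          refine (abs_real_inner_le_norm _ _).trans ?_
          gcongr
          exact (norm_snd_le p).trans (by simp)
      _ = ‖v‖ * ((1 + ‖p‖) ^ (k + 1) * ‖F p‖) := by ring
      _ ≤ ‖v‖ * M := by gcongr; exact hM p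

/-- The scalar time-frequency shift `x ↦ e^{i⟨b, x⟩} g(x - a)`. -/
noncomputable def shift (g : 𝓢(Rn n, ℂ)) (p : Rn n × Rn n) (x : Rn n) : ℂ :=
  Complex.exp (Complex.I * ((inner ℝ p.2 x : ℝ) : ℂ)) * g (x - p.1)

lemma norm_shift (g : 𝓢(Rn n, ℂ)) (p : Rn n × Rn n) (x : Rn n) :
    ‖shift g p x‖ = ‖g (x - p.1)‖ := by
  rw [shift, norm_mul, Complex.norm_exp_I_mul_ofReal, one_mul]

lemma continuous_shift (g : 𝓢(Rn n, ℂ)) {X : Type*} [TopologicalSpace X] {p : X → Rn n × Rn n}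
    {x : X → Rn n} (hp : Continuous p) (hx : Continuous x) :
    Continuous fun t => shift g (p t) (x t) := by
  have := g.continuous
  unfold shift
  fun_prop

/-- The derivative of `shift g p`. -/
noncomputable def shiftDeriv (g : 𝓢(Rn n, ℂ)) (p : Rn n × Rn n) (x : Rn n) : Rn n →L[ℝ] ℂ :=
  Complex.exp (Complex.I * ((inner ℝ p.2 x : ℝ) : ℂ)) • fderiv ℝ g (x - p.1) +
    (Complex.I * shift g p x) • Complex.ofRealCLM.comp (innerSL ℝ p.2)

lemma shiftDeriv_apply (g : 𝓢(Rn n, ℂ)) (p : Rn n × Rn n) (x v : Rn n) :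
    shiftDeriv g p x v = shift (LineDeriv.lineDerivOp v g) p x +
      shift g p x * (Complex.I * ((inner ℝ p.2 v : ℝ) : ℂ)) := by
  simp only [shiftDeriv, add_apply, smul_apply, shift, SchwartzMap.lineDerivOp_apply_eq_fderiv,
    ContinuousLinearMap.comp_apply, innerSL_apply_apply, Complex.ofRealCLM_apply, smul_eq_mul]
  ring

lemma hasFDerivAt_shift (g : 𝓢(Rn n, ℂ)) (p : Rn n × Rn n) (x : Rn n) :
    HasFDerivAt (shift g p) (shiftDeriv g p x) x := by
  have h0 : HasFDerivAt (fun x : Rn n => ((inner ℝ p.2 x : ℝ) : ℂ))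
      (Complex.ofRealCLM.comp (innerSL ℝ p.2)) x :=
    (Complex.ofRealCLM.comp (innerSL ℝ p.2)).hasFDerivAt
  have h1 := (h0.const_mul Complex.I).cexp
  have h2 : HasFDerivAt (fun x => g (x - p.1)) (fderiv ℝ g (x - p.1)) x := by
    have h3 : HasFDerivAt (fun x => x - p.1) (ContinuousLinearMap.id ℝ (Rn n)) x :=
      (hasFDerivAt_id x).sub_const p.1
    exact (g.differentiableAt.hasFDerivAt (x := x - p.1)).comp x h3
  refine (h1.mul h2).congr_fderiv ?_
  rw [shiftDeriv, shift]
  congr 1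
  rw [smul_smul, smul_smul]
  congr 1
  ring

lemma continuous_shiftDeriv (g : 𝓢(Rn n, ℂ)) (x : Rn n) :
    Continuous fun p => shiftDeriv g p x := by
  have h1 : Continuous (fderiv ℝ g) := (g.smooth 1).continuous_fderiv (by simp)
  have h2 : Continuous fun p => shift g p x :=
    continuous_shift g continuous_id continuous_const
  have h6 : Continuous fun p : Rn n × Rn n => innerSL ℝ p.2 :=
    (innerSL ℝ (E := Rn n)).continuous.comp continuous_snd
  have h3 : Continuous fun p : Rn n × Rn n => Complex.ofRealCLM.comp (innerSL ℝ p.2) :=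
    (ContinuousLinearMap.compL ℝ (Rn n) ℝ ℂ Complex.ofRealCLM).continuous.comp h6
  have h4 : Continuous fun p : Rn n × Rn n => fderiv ℝ g (x - p.1) :=
    h1.comp (continuous_const.sub continuous_fst)
  have h5 : Continuous fun p : Rn n × Rn n =>
      Complex.exp (Complex.I * ((inner ℝ p.2 x : ℝ) : ℂ)) := by fun_prop
  exact (h5.smul h4).add
    ((continuous_const.mul h2).smul h3)

/-- The linear growth in `p` comes from differentiating the modulation. Uniformity in `x` gives the
majorant for differentiating under the integral. -/
lemma exists_norm_shiftDeriv_le (g : 𝓢(Rn n, ℂ)) :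
    ∃ M, 0 ≤ M ∧ ∀ p x, ‖shiftDeriv g p x‖ ≤ M * (1 + ‖p‖) := by
  obtain ⟨M₀, h₀, H₀⟩ := exists_one_add_norm_pow_mul_le g 0
  obtain ⟨M₁, h₁, H₁⟩ := exists_one_add_norm_pow_mul_le (SchwartzMap.fderivCLM ℝ _ _ g) 0
  simp only [pow_zero, one_mul, SchwartzMap.fderivCLM_apply] at H₀ H₁
  refine ⟨M₀ + M₁, by positivity, fun p x => ?_⟩
  have h2 : ‖Complex.ofRealCLM.comp (innerSL ℝ p.2)‖ ≤ ‖p‖ := by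
    refine (ContinuousLinearMap.opNorm_comp_le _ _).trans ?_
    simpa using norm_snd_le p
  calc ‖shiftDeriv g p x‖ ≤ 1 * M₁ + M₀ * ‖p‖ := by
        refine (norm_add_le _ _).trans (add_le_add ?_ ?_)
        · rw [norm_smul, Complex.norm_exp_I_mul_ofReal]
          gcongr
          exact H₁ _
        · rw [norm_smul, norm_mul, Complex.norm_I, one_mul, norm_shift]
          gcongr
          exact H₀ _
    _ ≤ (M₀ + M₁) * (1 + ‖p‖) := by
        have := mul_nonneg h₁ (norm_nonneg p)
        linarith

lemma norm_clm_smulRight_le {V : Type*} [NormedAddCommGroup V] [NormedSpace ℝ V] (L : V →L[ℝ] ℂ)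
    (c : C) : ‖L.smulRight c‖ ≤ ‖L‖ * ‖c‖ :=
  ContinuousLinearMap.opNorm_le_bound _ (by positivity) fun v => by
    rw [ContinuousLinearMap.smulRight_apply, norm_smul, mul_right_comm]
    gcongr
    exact L.le_opNorm v

instance : (volume : Measure (Rn n × Rn n)).IsAddHaarMeasure :=
  inferInstanceAs ((volume : Measure (Rn n)).prod (volume : Measure (Rn n))).IsAddHaarMeasure

/-- The superposition of the time-frequency shifts of `g` with coefficients `F`. -/
noncomputable def synthesis (F : Rn n × Rn n → C) (g : 𝓢(Rn n, ℂ)) (x : Rn n) : C :=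
  ∫ p, shift g p x • F p

lemma integrable_shift_smul {F : Rn n × Rn n → C} (hF : RapidDecay F) (g : 𝓢(Rn n, ℂ))
    (x : Rn n) : Integrable fun p => shift g p x • F p := by
  obtain ⟨M, -, H⟩ := exists_one_add_norm_pow_mul_le g 0
  simp only [pow_zero, one_mul] at H
  exact hF.integrable.bdd_smul M (continuous_shift g continuous_id continuous_const).aestronglyMeasurable
    (Filter.Eventually.of_forall fun p => (norm_shift g p x).trans_le (H _))

/-- Differentiation under the integral. The derivative falls on the window or on the modulation, and
either way the result is again a synthesis, with a new window or new coefficients. -/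
lemma exists_hasFDerivAt_synthesis {F : Rn n × Rn n → C} (hF : RapidDecay F) (g : 𝓢(Rn n, ℂ))
    (x : Rn n) :
    ∃ D : Rn n →L[ℝ] C, HasFDerivAt (synthesis F g) D x ∧ ∀ v,
      D v = synthesis F (LineDeriv.lineDerivOp v g) x +
        synthesis (fun p => (Complex.I * ((inner ℝ p.2 v : ℝ) : ℂ)) • F p) g x := by
  obtain ⟨M, hM, H⟩ := exists_norm_shiftDeriv_le g
  have hcont : ∀ y, Continuous fun p => (shiftDeriv g p y).smulRight (F p) := fun y =>
    ((ContinuousLinearMap.lsmul ℝ ℂ).flip.continuous.comp hF.1).clm_comp (continuous_shiftDeriv g y)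
  have hbound : Integrable fun p => M * ((1 + ‖p‖) ^ 1 * ‖F p‖) :=
    (hF.integrable_pow_mul 1).const_mul M
  have hle : ∀ p y, ‖(shiftDeriv g p y).smulRight (F p)‖ ≤ M * ((1 + ‖p‖) ^ 1 * ‖F p‖) := by
    intro p y
    refine (norm_clm_smulRight_le _ _).trans ?_
    rw [pow_one, ← mul_assoc]
    gcongr
    exact H p y
  have hint : Integrable fun p => (shiftDeriv g p x).smulRight (F p) :=
    hbound.mono' (hcont x).aestronglyMeasurable (Filter.Eventually.of_forall fun p => hle p x)
  refine ⟨∫ p, (shiftDeriv g p x).smulRight (F p), ?_, fun v => ?_⟩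
  · refine hasFDerivAt_integral_of_dominated_of_fderiv_le (s := Set.univ)
      (F' := fun y p => (shiftDeriv g p y).smulRight (F p)) Filter.univ_mem
      (Filter.Eventually.of_forall fun y => (integrable_shift_smul hF g y).aestronglyMeasurable)
      (integrable_shift_smul hF g x) hint.aestronglyMeasurable
      (Filter.Eventually.of_forall fun p y _ => hle p y) hbound
      (Filter.Eventually.of_forall fun p y _ => ?_)
    refine ((hasFDerivAt_shift g p y).smul_const (F p)).congr_fderiv ?_
    rfl
  · rw [ContinuousLinearMap.integral_apply hint, synthesis, synthesis, ← integral_add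
      (integrable_shift_smul hF _ x) (integrable_shift_smul (hF.smul_coord v) g x)]
    refine integral_congr_ae (Filter.Eventually.of_forall fun p => ?_)
    simp only [ContinuousLinearMap.smulRight_apply, shiftDeriv_apply, add_smul, smul_smul]

lemma exists_norm_synthesis_le {F : Rn n × Rn n → C} (hF : RapidDecay F) (g : 𝓢(Rn n, ℂ))
    (k : ℕ) : ∃ M, ∀ x, ‖x‖ ^ k * ‖synthesis F g x‖ ≤ M := by
  obtain ⟨M, hM, H⟩ := exists_one_add_norm_pow_mul_le g k
  refine ⟨∫ p, M * ((1 + ‖p‖) ^ k * ‖F p‖), fun x => ?_⟩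
  have hx : 0 ≤ ‖x‖ ^ k := by positivity
  rw [← Real.norm_of_nonneg hx, ← norm_smul, synthesis, ← integral_smul]
  refine norm_integral_le_of_norm_le ((hF.integrable_pow_mul k).const_mul M)
    (Filter.Eventually.of_forall fun p => ?_)
  rw [norm_smul, norm_smul, norm_shift, Real.norm_of_nonneg hx]
  -- A Peetre-type inequality: powers of `‖x‖` are shared between the decay of the translated window
  -- and the decay of the coefficients.
  have h1 : ‖x‖ ≤ (1 + ‖x - p.1‖) * (1 + ‖p‖) := by
    have h2 : ‖x‖ ≤ ‖x - p.1‖ + ‖p.1‖ := by simpa using norm_add_le (x - p.1) p.1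
    have h3 := norm_fst_le p
    nlinarith [norm_nonneg (x - p.1), norm_nonneg p]
  calc ‖x‖ ^ k * (‖g (x - p.1)‖ * ‖F p‖)
      ≤ ((1 + ‖x - p.1‖) * (1 + ‖p‖)) ^ k * (‖g (x - p.1)‖ * ‖F p‖) := by gcongr
    _ = ((1 + ‖x - p.1‖) ^ k * ‖g (x - p.1)‖) * ((1 + ‖p‖) ^ k * ‖F p‖) := by
      rw [mul_pow]; ring
    _ ≤ M * ((1 + ‖p‖) ^ k * ‖F p‖) := by gcongr; exact H _

lemma decayingDeriv_synthesis (m : ℕ) {F : Rn n × Rn n → C} (hF : RapidDecay F)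
    (g : 𝓢(Rn n, ℂ)) : DecayingDeriv m (synthesis F g) := by
  induction m generalizing F g with
  | zero =>
    refine ⟨contDiff_zero.2 (continuous_iff_continuousAt.2 fun x => ?_), fun k => ?_⟩
    · obtain ⟨D, hD, -⟩ := exists_hasFDerivAt_synthesis hF g x
      exact hD.continuousAt
    · simpa only [norm_iteratedFDeriv_zero] using exists_norm_synthesis_le hF g k
  | succ m ih =>
    choose D hD hD' using exists_hasFDerivAt_synthesis hF g
    refine .of_coord (fun x => (hD x).differentiableAt) fun i => ?_
    simp only [(hD _).fderiv, hD']
    exact (ih hF _).add (ih (hF.smul_coord _) g)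

/-- `synthesis` as a Schwartz function. -/
noncomputable def synthesisSchwartz {F : Rn n × Rn n → C} (hF : RapidDecay F) (g : 𝓢(Rn n, ℂ)) :
    𝓢(Rn n, C) where
  toFun := synthesis F g
  smooth' := contDiff_infty.2 fun m => (decayingDeriv_synthesis m hF g).1
  decay' k m := (decayingDeriv_synthesis m hF g).2 k

end Synthesis

/-! ### The short-time Fourier transform: orthogonality relation and inversion. -/

section Gabor

open scoped FourierTransform

variable {n : ℕ} {C : Type*} [CStarAlgebra C]

variable (C) in
/-- A scalar Schwartz function, as a Schwartz function with values in `C`. -/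
noncomputable def window (g : 𝓢(Rn n, ℂ)) : 𝓢(Rn n, C) :=
  SchwartzMap.postcompCLM ((ContinuousLinearMap.toSpanSingleton ℂ (1 : C)).restrictScalars ℝ) g

lemma window_apply (g : 𝓢(Rn n, ℂ)) (x : Rn n) : window C g x = g x • (1 : C) := rfl

lemma schwartzOp_window (g : 𝓢(Rn n, ℂ)) (p : Rn n × Rn n) (x : Rn n) :
    schwartzOp p.1 p.2 0 (window C g) x = shift g p x • (1 : C) := by
  rw [schwartzOp_apply, window_apply, smul_smul, shift]
  simp

/-- The short-time Fourier transform of `u` with window `g`. -/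
noncomputable def gabor (g : 𝓢(Rn n, ℂ)) (u : E n C) (p : Rn n × Rn n) : C :=
  pairing n C (weylOrbit (toE n C (window C g)) p) u

lemma gabor_sub (g : 𝓢(Rn n, ℂ)) (u v : E n C) (p : Rn n × Rn n) :
    gabor g (u - v) p = gabor g u p - gabor g v p := map_sub _ _ _

lemma norm_gabor_le (g : 𝓢(Rn n, ℂ)) (u : E n C) (p : Rn n × Rn n) :
    ‖gabor g u p‖ ≤ ‖toE n C (window C g)‖ * ‖u‖ := by
  rw [← norm_weylOrbit (toE n C (window C g)) p]
  exact norm_pairing_le _ _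

/-- The decay of matrix coefficients needs smoothness on both sides; the window supplies it because
Schwartz functions are smooth vectors. -/
lemma IsSmoothVec.rapidDecay_gabor {u : E n C} (hu : IsSmoothVec u) (g : 𝓢(Rn n, ℂ)) :
    RapidDecay (gabor g u) :=
  rapidDecay_of_pow_mul_le (IsSmoothVec.continuous_pairing u (isSmoothVec_toE _))
    fun k => (isSmoothVec_toE _).pairing_decay k hu

lemma gabor_toE (g : 𝓢(Rn n, ℂ)) (f : 𝓢(Rn n, C)) (p : Rn n × Rn n) :
    gabor g (toE n C f) p = ∫ x, star (shift g p x) • f x := by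
  rw [gabor, weylOrbit, weylOp_toE, pairing_toE]
  simp only [schwartzOp_window, star_smul, star_one, smul_mul_assoc, one_mul]

lemma star_gabor_toE (g : 𝓢(Rn n, ℂ)) (f : 𝓢(Rn n, C)) (p : Rn n × Rn n) :
    star (gabor g (toE n C f) p) = ∫ x, shift g p x • star (f x) := by
  rw [gabor_toE]
  have hint := integrable_star_mul_schwartz (schwartzOp p.1 p.2 0 (window C g)) f
  simp only [schwartzOp_window, star_smul, star_one, smul_mul_assoc, one_mul] at hint
  have := ((starL' ℝ : C ≃L[ℝ] C) : C →L[ℝ] C).integral_comp_comm hint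
  simpa using this.symm

/-- The Schwartz function `x ↦ conj (g (x - a)) • f x`. -/
noncomputable def localize (g : 𝓢(Rn n, ℂ)) (a : Rn n) (f : 𝓢(Rn n, C)) : 𝓢(Rn n, C) :=
  SchwartzMap.smulLeftCLM C (SchwartzMap.postcompCLM
    (Complex.conjCLE : ℂ →L[ℝ] ℂ) (SchwartzMap.compSubConstCLM ℝ a g)) f

lemma localize_apply (g : 𝓢(Rn n, ℂ)) (a : Rn n) (f : 𝓢(Rn n, C)) (x : Rn n) :
    localize g a f x = star (g (x - a)) • f x := by
  rw [localize, SchwartzMap.smulLeftCLM_apply_apply (SchwartzMap.hasTemperateGrowth _)]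
  rfl

/-- With the translation `a` frozen, the transform is an ordinary Fourier transform in the
frequency. The scaling of `b` accounts for the factor `2π` in the exponent of `𝓕`. -/
lemma gabor_toE_eq_fourier (g : 𝓢(Rn n, ℂ)) (f : 𝓢(Rn n, C)) (a b : Rn n) :
    gabor g (toE n C f) (a, b) = 𝓕 (localize g a f) ((2 * Real.pi)⁻¹ • b) := by
  rw [gabor_toE, SchwartzMap.fourier_coe, Real.fourier_eq']
  refine integral_congr_ae (Filter.Eventually.of_forall fun x => ?_)
  simp only [localize_apply, shift, star_mul', smul_smul]
  congr 2
  rw [Complex.star_def, ← Complex.exp_conj, inner_smul_right, real_inner_comm x b]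
  congr 1
  have : (Real.pi : ℂ) ≠ 0 := by exact_mod_cast Real.pi_ne_zero
  simp
  field_simp

variable (C) in
/-- The sesquilinear multiplication `(x, y) ↦ x* y`. -/
noncomputable def starMul : C →L⋆[ℂ] C →L[ℂ] C :=
  (ContinuousLinearMap.mul ℂ C).comp ((starL ℂ : C ≃L⋆[ℂ] C) : C →L⋆[ℂ] C)

lemma starMul_apply (x y : C) : starMul C x y = star x * y := rfl

/-- Plancherel in the frequency variable; `(2π) ^ n` is the Jacobian of the rescaling of `b`. -/
lemma integral_star_gabor_mul_gabor_snd (g : 𝓢(Rn n, ℂ)) (h f : 𝓢(Rn n, C)) (a : Rn n) :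
    ∫ b, star (gabor g (toE n C h) (a, b)) * gabor g (toE n C f) (a, b) =
      ((2 * Real.pi) ^ n : ℝ) • ∫ x, (star (g (x - a)) * g (x - a)) • (star (h x) * f x) := by
  simp only [gabor_toE_eq_fourier]
  rw [Measure.integral_comp_inv_smul_of_nonneg volume
    (fun b => star (𝓕 (localize g a h) b) * 𝓕 (localize g a f) b) (by positivity)]
  have := SchwartzMap.integral_sesq_fourier_fourier (localize g a h) (localize g a f) (starMul C)
  simp only [starMul_apply] at this
  rw [this, finrank_euclideanSpace_fin]
  congr 1
  refine integral_congr_ae (Filter.Eventually.of_forall fun x => ?_)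
  simp only [localize_apply, star_smul, star_star, smul_mul_smul_comm]
  rw [mul_comm]

/-- The inner integral is a convolution evaluated at `a`, and the integral of a convolution is the
product of the integrals. The reflected function `hg` is used because the window is evaluated at `x
- a` instead of `a - x`. -/
lemma integral_integral_sq_smul (g : 𝓢(Rn n, ℂ)) {s : Rn n → C} (hs : Integrable s) :
    ∫ a, ∫ x, (star (g (x - a)) * g (x - a)) • s x = (∫ x, star (g x) * g x) • ∫ x, s x := by
  have hg : Integrable fun y => star (g (-y)) * g (-y) :=
    (integrable_star_mul_schwartz g g).comp_neg
  have h := integral_convolution ((ContinuousLinearMap.lsmul ℝ ℂ : ℂ →L[ℝ] C →L[ℝ] C).flip)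
    hs hg
  rw [integral_neg_eq_self (fun y => star (g y) * g y) volume] at h
  simpa [convolution] using h

/-- The orthogonality relation for the short-time Fourier transform of Schwartz functions. -/
lemma integral_star_gabor_mul_gabor (g : 𝓢(Rn n, ℂ)) (h f : 𝓢(Rn n, C)) :
    ∫ p, star (gabor g (toE n C h) p) * gabor g (toE n C f) p =
      (((2 * Real.pi) ^ n : ℝ) • ∫ x, star (g x) * g x) • pairing n C (toE n C h) (toE n C f) := by
  have hint : Integrable fun p => star (gabor g (toE n C h) p) * gabor g (toE n C f) p :=
    ((isSmoothVec_toE f).rapidDecay_gabor g).integrable.bdd_mul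
      ((isSmoothVec_toE h).rapidDecay_gabor g).1.star.aestronglyMeasurable
      (Filter.Eventually.of_forall fun p => by rw [norm_star]; exact norm_gabor_le _ _ _)
  rw [Measure.volume_eq_prod] at hint ⊢
  rw [integral_prod _ hint]
  simp only [integral_star_gabor_mul_gabor_snd]
  rw [integral_smul, integral_integral_sq_smul g (integrable_star_mul_schwartz h f), pairing_toE,
    smul_assoc]

/-- The orthogonality relation between a Schwartz function and a smooth vector. -/
lemma IsSmoothVec.integral_star_gabor_mul_gabor {u : E n C} (hu : IsSmoothVec u)
    (g : 𝓢(Rn n, ℂ)) (h : 𝓢(Rn n, C)) :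
    ∫ p, star (gabor g (toE n C h) p) * gabor g u p =
      (((2 * Real.pi) ^ n : ℝ) • ∫ x, star (g x) * g x) • pairing n C (toE n C h) u := by
  set κ : ℂ := ((2 * Real.pi) ^ n : ℝ) • ∫ x, star (g x) * g x
  have hh := (isSmoothVec_toE h).rapidDecay_gabor g
  have hint : ∀ {v : E n C}, IsSmoothVec v →
      Integrable fun p => star (gabor g (toE n C h) p) * gabor g v p := fun hv =>
    (hv.rapidDecay_gabor g).integrable.bdd_mul hh.1.star.aestronglyMeasurable
      (Filter.Eventually.of_forall fun p => by rw [norm_star]; exact norm_gabor_le _ _ _)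
  -- `K` bounds the difference of the two sides as a function of `u`: `gabor g (toE n C h)` is
  -- integrable and `gabor g u` is bounded by a multiple of `‖u‖`.
  set K : ℝ := (∫ p, ‖gabor g (toE n C h) p‖) * ‖toE n C (window C g)‖ + ‖κ‖ * ‖toE n C h‖ with hK
  have hK0 : 0 ≤ K := by positivity
  rw [← sub_eq_zero, ← norm_le_zero_iff]
  refine le_of_forall_pos_le_add fun ε hε => ?_
  -- Dividing by `K + 1` avoids the case `K = 0`.
  obtain ⟨f, hf⟩ := exists_toE_norm_sub_lt u (ε := ε / (K + 1)) (by positivity)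
  -- The relation already holds for the approximant `f`, so the defect for `u` equals the defect for
  -- `u - f`.
  have hsub : (∫ p, star (gabor g (toE n C h) p) * gabor g u p) - κ • pairing n C (toE n C h) u =
      (∫ p, star (gabor g (toE n C h) p) * gabor g (u - toE n C f) p) -
        κ • pairing n C (toE n C h) (u - toE n C f) := by
    have h1 : ∫ p, star (gabor g (toE n C h) p) * gabor g (u - toE n C f) p =
        (∫ p, star (gabor g (toE n C h) p) * gabor g u p) -
          ∫ p, star (gabor g (toE n C h) p) * gabor g (toE n C f) p := by
      simp only [gabor_sub, mul_sub]
      exact integral_sub (hint hu) (hint (isSmoothVec_toE f))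
    rw [h1, HeisenbergSmooth.integral_star_gabor_mul_gabor, map_sub, smul_sub]
    abel
  have h2 : ‖∫ p, star (gabor g (toE n C h) p) * gabor g (u - toE n C f) p‖ ≤
      (∫ p, ‖gabor g (toE n C h) p‖) * (‖toE n C (window C g)‖ * ‖u - toE n C f‖) := by
    rw [← integral_mul_const]
    refine norm_integral_le_of_norm_le (hh.integrable.norm.mul_const _)
      (Filter.Eventually.of_forall fun p => ?_)
    refine (norm_mul_le _ _).trans ?_
    rw [norm_star]
    gcongr
    exact norm_gabor_le _ _ _
  calc _ ≤ (∫ p, ‖gabor g (toE n C h) p‖) * (‖toE n C (window C g)‖ * ‖u - toE n C f‖) +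
        ‖κ‖ * (‖toE n C h‖ * ‖u - toE n C f‖) := by
        rw [hsub]
        refine (norm_sub_le _ _).trans (add_le_add h2 ?_)
        rw [norm_smul]
        gcongr
        exact norm_pairing_le _ _
    _ = K * ‖u - toE n C f‖ := by rw [hK]; ring
    _ ≤ (K + 1) * (ε / (K + 1)) := by gcongr; linarith
    _ = 0 + ε := by field_simp; ring

/-- Fubini: synthesis is the adjoint of the short-time Fourier transform. -/
lemma pairing_toE_synthesisSchwartz {F : Rn n × Rn n → C} (hF : RapidDecay F) (g : 𝓢(Rn n, ℂ))
    (h : 𝓢(Rn n, C)) :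
    pairing n C (toE n C h) (toE n C (synthesisSchwartz hF g)) =
      ∫ p, star (gabor g (toE n C h) p) * F p := by
  obtain ⟨M, -, H⟩ := exists_one_add_norm_pow_mul_le g 0
  simp only [pow_zero, one_mul] at H
  have hh : Integrable fun x => star (h x) :=
    ((starL' ℝ : C ≃L[ℝ] C) : C →L[ℝ] C).integrable_comp (SchwartzMap.integrable h)
  have hint : Integrable (Function.uncurry fun (x : Rn n) (p : Rn n × Rn n) =>
      shift g p x • (star (h x) * F p)) (volume.prod volume) := by
    have hc : Continuous fun z : Rn n × (Rn n × Rn n) => shift g z.2 z.1 :=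
      continuous_shift g continuous_snd continuous_fst
    exact (hh.mul_prod hF.integrable).bdd_smul M hc.aestronglyMeasurable
      (Filter.Eventually.of_forall fun z => (norm_shift g z.2 z.1).trans_le (H _))
  rw [pairing_toE]
  calc ∫ x, star (h x) * synthesis F g x
      = ∫ x, ∫ p, shift g p x • (star (h x) * F p) := by
        refine integral_congr_ae (Filter.Eventually.of_forall fun x => ?_)
        simp only [synthesis, ← mul_smul_comm]
        exact ((ContinuousLinearMap.mul ℝ C (star (h x))).integral_comp_comm
          (integrable_shift_smul hF g x)).symm
    _ = ∫ p, ∫ x, shift g p x • (star (h x) * F p) := integral_integral_swap hint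
    _ = ∫ p, star (gabor g (toE n C h) p) * F p := by
        refine integral_congr_ae (Filter.Eventually.of_forall fun p => ?_)
        simp only [star_gabor_toE, ← smul_mul_assoc]
        have hi : Integrable fun x => shift g p x • star (h x) := by
          have hc : Continuous fun x => shift g p x :=
            continuous_shift g continuous_const continuous_id
          exact hh.bdd_smul M hc.aestronglyMeasurable
            (Filter.Eventually.of_forall fun x => (norm_shift g p x).trans_le (H _))
        exact ((ContinuousLinearMap.mul ℝ C).flip (F p)).integral_comp_comm hi

-- Definiteness of the inner product makes any nonzero window admissible; a bump function is one.
variable (n) in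
lemma exists_window_integral_ne_zero :
    ∃ g : 𝓢(Rn n, ℂ), (∫ x, star (g x) * g x) ≠ 0 := by
  let φ : ContDiffBump (0 : Rn n) := default
  have hsupp : HasCompactSupport fun x => (φ x : ℂ) :=
    φ.hasCompactSupport.comp_left Complex.ofReal_zero
  let g : 𝓢(Rn n, ℂ) := hsupp.toSchwartzMap (Complex.ofRealCLM.contDiff.comp φ.contDiff)
  refine ⟨g, fun h => ?_⟩
  have h0 : toPreE g = 0 := preInner_self_eq_zero h
  have h1 : g 0 = 0 := congrArg (fun f : PreE n ℂ => f 0) h0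
  have h2 : φ 0 = 1 := φ.one_of_mem_closedBall (Metric.mem_closedBall_self φ.rIn_pos.le)
  have h3 : ((φ 0 : ℝ) : ℂ) = 0 := h1
  simp [h2] at h3

/-- Smooth vectors are Schwartz functions. -/
lemma IsSmoothVec.mem_range_toE {u : E n C} (hu : IsSmoothVec u) :
    u ∈ LinearMap.range (toE n C) := by
  obtain ⟨g, hg⟩ := exists_window_integral_ne_zero n
  set κ : ℂ := ((2 * Real.pi) ^ n : ℝ) • ∫ x, star (g x) * g x with hκ
  have hκ0 : κ ≠ 0 := smul_ne_zero (by positivity) hg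
  have hF := hu.rapidDecay_gabor g
  -- The weak inversion formula: both vectors have the same pairing with every Schwartz function,
  -- one by orthogonality and the other by adjointness.
  have h : κ • u - toE n C (synthesisSchwartz hF g) = 0 := by
    refine eq_zero_of_pairing_toE_eq_zero fun h => ?_
    rw [map_sub, map_smul, pairing_toE_synthesisSchwartz, hu.integral_star_gabor_mul_gabor,
      sub_self]
  refine ⟨κ⁻¹ • synthesisSchwartz hF g, ?_⟩
  rw [map_smul, ← sub_eq_zero.1 h, inv_smul_smul₀ hκ0]

lemma isSmoothVec_iff_mem_range (u : E n C) : IsSmoothVec u ↔ u ∈ LinearMap.range (toE n C) :=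
  ⟨IsSmoothVec.mem_range_toE, by rintro ⟨f, rfl⟩; exact isSmoothVec_toE f⟩

end Gabor

end HeisenbergSmooth

/-! ### The theorem, for both signs of the central character. -/

open HeisenbergSmooth

theorem theorem2p2 (n : ℕ) (C : Type*) [CStarAlgebra C] :
    smoothVectors (Rn n × Rn n × ℝ) (heisenbergRep n C) = LinearMap.range (toE n C) ∧
    smoothVectors (Rn n × Rn n × ℝ)
        (fun g : Heisenberg n => (weylOp g.a g.b g.c : E n C ≃ₗᵢ[ℂ] E n C)) =
      LinearMap.range (toE n C) := by
  constructor
  · ext u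
    rw [← isSmoothVec_iff_mem_range, ← mem_smoothVectors_iff (ε := -1)]
    simp only [neg_one_mul]
    rfl
  · ext u
    rw [← isSmoothVec_iff_mem_range, ← mem_smoothVectors_iff (ε := 1)]
    simp only [one_mul]
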